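/- For $p>-1$ let $J_p$ be the Laguerre Jacobi operator in $\ell^2(\mathbb{Z}_+)$, $$(J_pf)_n=a_{n-1}^{(p)}f_{n-1}+b_n^{(p)}f_n+a_n^{(p)}f_{n+1}\quad(a_{-1}^{(p)}=0),\qquad a_n^{(p)}=\sqrt{(n+1)(n+1+p)},\quad b_n^{(p)}=2n+p+1,$$ with domain $\{f\in\ell^2(\mathbb{Z}_+): J_pf\in\ell^2(\mathbb{Z}_+)\}$. Let $L_n^{(p)}$ be the polynomials with $L_{-1}^{(p)}=0$, $L_0^{(p)}=1$ and $a_{n-1}^{(p)}L_{n-1}^{(p)}(\lambda)+b_n^{(p)}L_n^{(p)}(\lambda)+a_n^{(p)}L_{n+1}^{(p)}(\lambda)=\lambda L_n^{(p)}(\lambda)$ (normalized Laguerre polynomials), and put $$\varphi_n^{(p)}(\lambda)=\sqrt{\frac{\lambda^pe^{-\lambda}}{\Gamma(p+1)}}\;L_n^{(p)}(\lambda),\qquad \lambda>0 .$$ Then for every $p>-1$ there is a unique unitary operator $\Phi_p:\ell^2(\mathbb{Z}_+)\to L^2(\mathbb{R}_+)$ with $(\Phi_pf)(\lambda)=\sum_n\varphi_n^{(p)}(\lambda)f_n$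 for all finitely supported $f$, and it diagonalizes $J_p$: for $f,g\in\ell^2(\mathbb{Z}_+)$, one has $f\in\mathcal{D}(J_p)$ and $J_pf=g$ if and only if $(\Phi_pg)(\lambda)=\lambda(\Phi_pf)(\lambda)$ for almost every $\lambda>0$. For all $p,q>-1$ the wave operators, that is, the strong limits $$W_\pm(J_q,J_p)=\operatorname*{s-lim}_{t\to\pm\infty}e^{iJ_qt}e^{-iJ_pt},$$ exist, and $$W_\pm(J_q,J_p)=e^{\pm i(q-p)\pi/2}\,\Phi_q^*\Phi_p ,$$ although for $p\neq q$ the operator $J_q-J_p$ is not compact (no compact operator on $\ell^2(\mathbb{Z}_+)$ agrees with it on $\mathcal{D}(J_q)\cap\mathcal{D}(J_p)$). -/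

import Mathlib

open MeasureTheory Filter Topology

noncomputable section

/-- The Hilbert space `ℓ²(ℤ₊)` of complex square-summable sequences. -/
abbrev EllTwo : Type := lp (fun _ : ℕ => ℂ) 2

/-- The Hilbert space `L²(ℝ₊)` of complex functions on `(0, ∞)`, with Lebesgue measure. -/
abbrev LTwoPos : Type := Lp ℂ 2 (volume.restrict (Set.Ioi (0 : ℝ)))

/-- The formal Jacobi matrix acting on arbitrary sequences:
`(J f)ₙ = aₙ₋₁ fₙ₋₁ + bₙ fₙ + aₙ fₙ₊₁` with `a₋₁ = 0`. -/
def jacobiMatrix (a b : ℕ → ℝ) : (ℕ → ℂ) →ₗ[ℂ] (ℕ → ℂ) where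
  toFun f := fun n => match n with
    | 0 => (b 0 : ℂ) * f 0 + (a 0 : ℂ) * f 1
    | n + 1 => (a n : ℂ) * f n + (b (n + 1) : ℂ) * f (n + 1) + (a (n + 1) : ℂ) * f (n + 2)
  map_add' f g := by
    funext n
    cases n <;> simp <;> ring
  map_smul' c f := by
    funext n
    cases n <;> simp <;> ring

/-- The Jacobi operator in `ℓ²(ℤ₊)`, with domain all `f ∈ ℓ²` such that `J f ∈ ℓ²`.
(When the operator on finitely supported sequences is essentially self-adjoint, e.g. when
`∑ 1 / aₙ = ∞`, this is its closure.) -/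
def jacobiOperator (a b : ℕ → ℝ) : EllTwo →ₗ.[ℂ] EllTwo where
  domain :=
    { carrier := {f | Memℓp (jacobiMatrix a b (f : ℕ → ℂ)) 2}
      add_mem' := fun {f g} hf hg => by
        simp only [Set.mem_ofPred_eq, lp.coeFn_add, map_add] at hf hg ⊢
        exact hf.add hg
      zero_mem' := by
        simp only [Set.mem_ofPred_eq, lp.coeFn_zero, map_zero]
        exact zero_memℓp
      smul_mem' := fun c f hf => by
        simp only [Set.mem_ofPred_eq, lp.coeFn_smul, map_smul] at hf ⊢
        exact hf.const_smul c }
  toFun :=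
    { toFun := fun f => ⟨jacobiMatrix a b ((f : EllTwo) : ℕ → ℂ), f.2⟩
      map_add' := fun f g => by
        apply Subtype.ext
        simp only [Submodule.coe_add, lp.coeFn_add, map_add]
        rfl
      map_smul' := fun c f => by
        apply Subtype.ext
        simp only [Submodule.coe_smul, lp.coeFn_smul, map_smul]
        rfl }

/-- `aₙ = √((n + 1)(n + 1 + p))`. -/
def laguerreA (p : ℝ) (n : ℕ) : ℝ := Real.sqrt (((n : ℝ) + 1) * ((n : ℝ) + 1 + p))

/-- `bₙ = 2n + p + 1`. -/
def laguerreB (p : ℝ) (n : ℕ) : ℝ := 2 * (n : ℝ) + p + 1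

/-- The Laguerre operator `J_p`. -/
def laguerreOperator (p : ℝ) : EllTwo →ₗ.[ℂ] EllTwo :=
  jacobiOperator (laguerreA p) (laguerreB p)

/-- The orthonormal polynomials `Pₙ(x)` of a Jacobi matrix: `P₋₁ = 0`, `P₀ = 1` and
`aₙ₋₁ Pₙ₋₁ + bₙ Pₙ + aₙ Pₙ₊₁ = x Pₙ`. -/
def orthoPoly (a b : ℕ → ℝ) (x : ℝ) : ℕ → ℝ
  | 0 => 1
  | 1 => (x - b 0) / a 0
  | n + 2 => ((x - b (n + 1)) * orthoPoly a b x (n + 1) - a n * orthoPoly a b x n) / a (n + 1)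

/-- The density `τ_p(x) = x ^ p e ^ (-x) / Γ(p + 1)` of the spectral measure. -/
def laguerreDensity (p x : ℝ) : ℝ := x ^ p * Real.exp (-x) / Real.Gamma (p + 1)

/-- The normalized Laguerre functions `φₙ(x) = √τ_p(x) Lₙ(x)`. -/
def laguerreFun (p : ℝ) (n : ℕ) (x : ℝ) : ℝ :=
  Real.sqrt (laguerreDensity p x) * orthoPoly (laguerreA p) (laguerreB p) x n

/-- The unitary operator `Φ : ℓ²(ℤ₊) → L²(ℝ₊)` is given on finitely supported sequences by
`(Φ f)(x) = ∑ₙ φₙ(x) fₙ`. -/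
def IsLaguerreTransform (p : ℝ) (Φ : EllTwo ≃ₗᵢ[ℂ] LTwoPos) : Prop :=
  ∀ (N : ℕ) (f : EllTwo), (∀ n, N ≤ n → (f : ℕ → ℂ) n = 0) →
    (Φ f : ℝ → ℂ) =ᵐ[volume.restrict (Set.Ioi (0 : ℝ))]
      fun x => ∑ n ∈ Finset.range N, (laguerreFun p n x : ℂ) * (f : ℕ → ℂ) n

/-- `U t = e ^ (-i A t)`: `U` is the strongly continuous one-parameter unitary group whose
generator is exactly `-i A` (equality of operators, including their domains). By Stone's theorem
such a `U` exists if and only if `A` is self-adjoint, and it is then unique. -/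
structure IsUnitaryGroupOf {H : Type*} [NormedAddCommGroup H] [InnerProductSpace ℂ H]
    (A : H →ₗ.[ℂ] H) (U : ℝ → H ≃ₗᵢ[ℂ] H) : Prop where
  map_zero : ∀ f, U 0 f = f
  map_add : ∀ s t f, U (s + t) f = U s (U t f)
  continuous : ∀ f, Continuous fun t => U t f
  generator : ∀ f g, (f, g) ∈ A.graph ↔ HasDerivAt (fun t => U t f) (-(Complex.I • g)) 0

/-- The strong limit of `e ^ (i B t) e ^ (-i A t)` along `l` exists and equals `W`. The wave
operators `W₊(B, A)` and `W₋(B, A)` are the cases `l = atTop` and `l = atBot`. -/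
def IsWaveOperator {H : Type*} [NormedAddCommGroup H] [InnerProductSpace ℂ H]
    (l : Filter ℝ) (B A : H →ₗ.[ℂ] H) (W : H →L[ℂ] H) : Prop :=
  ∃ UB UA : ℝ → H ≃ₗᵢ[ℂ] H, IsUnitaryGroupOf B UB ∧ IsUnitaryGroupOf A UA ∧
    ∀ f : H, Tendsto (fun t => UB (-t) (UA t f)) l (𝓝 (W f))

end

/-! Everything is reduced to the orbit of the first basis vector. In the spectral representation it
becomes `φ₀`, and the evolution becomes multiplication by `e^(-itx)`. The components of `e^(-itJ_p)
e₀` are explicit: `γₙ (1+it)^(-p-1) wⁿ` with `w = -it/(1+it)` (`laguerreFourier_orthoPolynomial`),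
because the Gamma distribution has Fourier transform `(1+it)^(-p-1)` and this sequence solves the
Schrödinger equation of `J_p`. At `t = 0` the formula gives the first row of the Gram matrix, from
which the recurrence produces orthonormality. For every `t` the squared moduli sum to 1, so the
orbit lies in the closed span of the `φₙ`; the orbit is total by uniqueness of Fourier transforms,
hence the `φₙ` form a basis.

The matrix element of the wave operator family between two orbit points `τ`, `τ'` is, up to explicit
prefactors, a power series with coefficients `√(Γ(n+p+1)Γ(n+q+1))/n!` at a point `z` with `1 - z ~
(1+i(τ-τ'))/t²`. The coefficients are asymptotic to `Γ(n+a)/n!`, `a = (p+q)/2+1`, whose series is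
`Γ(a)(1-z)^(-a)`, so an Abelian comparison (`tendsto_rpow_neg_mul_of_tendsto_ratio`) gives the
limit. The powers of `|t|` cancel, the phases of `(1+it)^(-p-1)` and of the conjugate of
`(1+it)^(-q-1)` combine to `e^(±i(q-p)π/2)`, and the remaining factor is `⟨φ₀^(q), e^(-i(τ-τ')x)
φ₀^(p)⟩`, since the product of the two ground states is a multiple of the Gamma density with
parameter `(p+q)/2`. Convergence of these matrix elements upgrades to strong convergence because all
operators involved are isometries (`tendsto_of_tendsto_inner_total`).

That multiplication by `x` has exactly the maximal domain of `J_p` comes from injectivity of `J_p -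
i` on `ℓ²`, a Carleman argument (`eq_zero_of_jacobiMatrix_eq_I_smul`). Compactness fails because
`J_q - J_p` has constant diagonal `q - p`. -/

/-! ### The Gamma distribution and its Fourier transform -/

/-- The probability measure on `ℝ` with density `laguerreDensity p` on `(0, ∞)`. -/
noncomputable def laguerreMeasure (p : ℝ) : Measure ℝ :=
  (volume.restrict (Set.Ioi (0 : ℝ))).withDensity
    fun x => ((laguerreDensity p x).toNNReal : ENNReal)

lemma measurable_laguerreDensity (p : ℝ) : Measurable (laguerreDensity p) := by
  unfold laguerreDensity
  fun_prop

lemma laguerreDensity_pos {p x : ℝ} (hp : -1 < p) (hx : 0 < x) : 0 < laguerreDensity p x := by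
  have : 0 < Real.Gamma (p + 1) := Real.Gamma_pos_of_pos (by linarith)
  unfold laguerreDensity
  positivity

lemma integral_laguerreMeasure {E : Type*} [NormedAddCommGroup E] [NormedSpace ℝ E]
    {p : ℝ} (hp : -1 < p) (f : ℝ → E) :
    ∫ x, f x ∂laguerreMeasure p = ∫ x in Set.Ioi (0 : ℝ), laguerreDensity p x • f x := by
  rw [laguerreMeasure, integral_withDensity_eq_integral_smul
    (measurable_laguerreDensity p).real_toNNReal]
  refine setIntegral_congr_fun measurableSet_Ioi fun x hx => ?_
  simp only [NNReal.smul_def, Real.coe_toNNReal _ (laguerreDensity_pos hp hx).le]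

lemma integrable_laguerreMeasure {E : Type*} [NormedAddCommGroup E] [NormedSpace ℝ E]
    {p : ℝ} (hp : -1 < p) {f : ℝ → E} :
    Integrable f (laguerreMeasure p) ↔
      IntegrableOn (fun x => laguerreDensity p x • f x) (Set.Ioi (0 : ℝ)) := by
  rw [laguerreMeasure, integrable_withDensity_iff_integrable_smul
    (measurable_laguerreDensity p).real_toNNReal]
  refine integrableOn_congr_fun (fun x hx => ?_) measurableSet_Ioi
  simp only [NNReal.smul_def, Real.coe_toNNReal _ (laguerreDensity_pos hp hx).le]

lemma mgf_laguerreMeasure {p t : ℝ} (hp : -1 < p) (ht : t < 1) :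
    ProbabilityTheory.mgf id (laguerreMeasure p) t = (1 - t) ^ (-(p + 1)) := by
  have hG : 0 < Real.Gamma (p + 1) := Real.Gamma_pos_of_pos (by linarith)
  have h := Real.integral_rpow_mul_exp_neg_mul_Ioi (a := p + 1) (r := 1 - t) (by linarith)
    (by linarith)
  rw [ProbabilityTheory.mgf, integral_laguerreMeasure hp, ← mul_left_inj' hG.ne',
    Real.rpow_neg (by linarith), ← Real.inv_rpow (by linarith), ← one_div, ← h,
    ← integral_mul_const]
  refine setIntegral_congr_fun measurableSet_Ioi fun x hx => ?_
  simp only [laguerreDensity, id, smul_eq_mul, add_sub_cancel_right]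
  rw [show -((1 - t) * x) = -x + t * x by ring, Real.exp_add]
  field_simp

/-- `mgf` takes the value 0 where the exponential is not integrable, whereas the Gamma integral
gives a positive value. -/
lemma integrable_exp_laguerreMeasure {p t : ℝ} (hp : -1 < p) (ht : t < 1) :
    Integrable (fun x => Real.exp (t * x)) (laguerreMeasure p) := by
  by_contra h
  have h1 := mgf_laguerreMeasure hp ht
  have h2 : ProbabilityTheory.mgf id (laguerreMeasure p) t = 0 := ProbabilityTheory.mgf_undef h
  exact (Real.rpow_pos_of_pos (by linarith) _).ne' (h1.symm.trans h2)

lemma mem_interior_integrableExpSet_laguerreMeasure {p t : ℝ} (hp : -1 < p) (ht : t < 1) :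
    t ∈ interior (ProbabilityTheory.integrableExpSet id (laguerreMeasure p)) :=
  mem_interior.2 ⟨Set.Iio 1, fun _ hs => integrable_exp_laguerreMeasure hp hs, isOpen_Iio, ht⟩

/-- Analytic continuation of the real formula across the half-plane `Re z < 1`, by the identity
theorem. -/
lemma complexMGF_laguerreMeasure {p : ℝ} (hp : -1 < p) {z : ℂ} (hz : z.re < 1) :
    ProbabilityTheory.complexMGF id (laguerreMeasure p) z = (1 - z) ^ (-((p : ℂ) + 1)) := by
  have hU : IsOpen {z : ℂ | z.re < 1} := isOpen_lt Complex.continuous_re continuous_const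
  have hslit : ∀ z : ℂ, z.re < 1 → 1 - z ∈ Complex.slitPlane := fun z hz =>
    Or.inl (by simpa using hz)
  have h1 : AnalyticOnNhd ℂ (ProbabilityTheory.complexMGF id (laguerreMeasure p))
      {z | z.re < 1} := fun z hz =>
    ProbabilityTheory.analyticAt_complexMGF (mem_interior_integrableExpSet_laguerreMeasure hp hz)
  have h2 : AnalyticOnNhd ℂ (fun z : ℂ => (1 - z) ^ (-((p : ℂ) + 1))) {z | z.re < 1} :=
    fun z hz => (analyticAt_const.sub analyticAt_id).cpow analyticAt_const (hslit z hz)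
  refine h1.eqOn_of_preconnected_of_frequently_eq h2
    (convex_halfSpace_re_lt 1).isPreconnected (z₀ := 0) (by simp) ?_ hz
  have hreal : ∀ t : ℝ, t < 1 → ProbabilityTheory.complexMGF id (laguerreMeasure p) t
      = (1 - (t : ℂ)) ^ (-((p : ℂ) + 1)) := by
    intro t ht
    rw [ProbabilityTheory.complexMGF_ofReal, mgf_laguerreMeasure hp ht,
      Complex.ofReal_cpow (by linarith)]
    push_cast
    rfl
  rw [frequently_iff_seq_forall]
  -- Real points below 1, distinct from 0 and accumulating there.
  refine ⟨fun n => ((-(1 / ((n : ℝ) + 1)) : ℝ) : ℂ), ?_, fun n => hreal _ ?_⟩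
  · rw [tendsto_nhdsWithin_iff]
    refine ⟨?_, Eventually.of_forall fun n => ?_⟩
    · have := (tendsto_one_div_add_atTop_nhds_zero_nat (𝕜 := ℝ)).neg
      rw [neg_zero] at this
      exact_mod_cast (Complex.continuous_ofReal.tendsto 0).comp this
    · have : (n : ℝ) + 1 ≠ 0 := by positivity
      simp only [Set.mem_compl_iff, Set.mem_singleton_iff, Complex.ofReal_eq_zero]
      simpa using this
  · have : 0 < 1 / ((n : ℝ) + 1) := by positivity
    linarith

open Polynomial in
lemma integrable_eval_mul_exp {p : ℝ} (hp : -1 < p) (P : ℝ[X]) (t : ℝ) :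
    Integrable (fun x : ℝ => ((P.eval x : ℝ) : ℂ) * Complex.exp (-(Complex.I * t * x)))
      (laguerreMeasure p) := by
  induction P using Polynomial.induction_on' with
  | add P Q hP hQ =>
    refine (hP.add hQ).congr (Eventually.of_forall fun x => ?_)
    simp; ring
  | monomial n c =>
    have h := ProbabilityTheory.integrable_pow_mul_cexp_of_re_mem_interior_integrableExpSet
      (X := id) (z := -(Complex.I * t)) (μ := laguerreMeasure p)
      (mem_interior_integrableExpSet_laguerreMeasure hp (by simp)) n
    refine (h.const_mul (c : ℂ)).congr (Eventually.of_forall fun x => ?_)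
    simp [mul_assoc]

open Polynomial in
lemma hasDerivAt_integral_eval_mul_exp {p : ℝ} (hp : -1 < p) (P : ℝ[X]) (t : ℝ) :
    HasDerivAt (fun t : ℝ => ∫ x, ((P.eval x : ℝ) : ℂ) * Complex.exp (-(Complex.I * t * x))
        ∂laguerreMeasure p)
      (-Complex.I * ∫ x, (((X * P).eval x : ℝ) : ℂ) * Complex.exp (-(Complex.I * t * x))
        ∂laguerreMeasure p) t := by
  induction P using Polynomial.induction_on' with
  | add P Q hP hQ =>
    have h := hP.add hQ
    rw [← mul_add, ← integral_add (integrable_eval_mul_exp hp _ _)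
      (integrable_eval_mul_exp hp _ _)] at h
    refine (h.congr_of_eventuallyEq (Eventually.of_forall fun s => ?_)).congr_deriv ?_
    · rw [Pi.add_apply, ← integral_add (integrable_eval_mul_exp hp _ _)
        (integrable_eval_mul_exp hp _ _)]
      simp [add_mul]
    · simp [add_mul, mul_add]
  | monomial n c =>
    have h := ProbabilityTheory.hasDerivAt_integral_pow_mul_exp
      (X := id) (z := -(Complex.I * t)) (μ := laguerreMeasure p)
      (mem_interior_integrableExpSet_laguerreMeasure hp (by simp)) n
    have h2 : HasDerivAt (fun t : ℝ => -(Complex.I * t)) (-Complex.I) t := by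
      simpa using ((hasDerivAt_id (t : ℂ)).const_mul Complex.I).neg.comp_ofReal
    have h3 := (h.comp t h2).const_mul (c : ℂ)
    refine (h3.congr_of_eventuallyEq (Eventually.of_forall fun s => ?_)).congr_deriv ?_
    · simp only [Function.comp, id]
      rw [← integral_const_mul]
      simp [mul_assoc]
    · rw [mul_comm _ (-Complex.I), mul_left_comm, ← integral_const_mul]
      simp [mul_assoc, pow_succ']

/-! ### Orthogonal polynomials and the evolution of the first basis vector -/

section Polynomials

open Polynomial

lemma laguerreA_pos {p : ℝ} (hp : -1 < p) (n : ℕ) : 0 < laguerreA p n := by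
  have : (0 : ℝ) ≤ n := n.cast_nonneg
  exact Real.sqrt_pos.2 (mul_pos (by linarith) (by linarith))

lemma laguerreA_sq {p : ℝ} (hp : -1 < p) (n : ℕ) :
    laguerreA p n ^ 2 = ((n : ℝ) + 1) * ((n : ℝ) + 1 + p) := by
  have : (0 : ℝ) ≤ n := n.cast_nonneg
  exact Real.sq_sqrt (mul_nonneg (by linarith) (by linarith))

lemma orthoPoly_recurrence_zero {a b : ℕ → ℝ} (ha : ∀ n, a n ≠ 0) (x : ℝ) :
    x * orthoPoly a b x 0 = b 0 * orthoPoly a b x 0 + a 0 * orthoPoly a b x 1 := by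
  simp only [orthoPoly]
  field_simp [ha 0]
  ring

lemma orthoPoly_recurrence_succ {a b : ℕ → ℝ} (ha : ∀ n, a n ≠ 0) (x : ℝ) (n : ℕ) :
    x * orthoPoly a b x (n + 1) = a n * orthoPoly a b x n
      + b (n + 1) * orthoPoly a b x (n + 1) + a (n + 1) * orthoPoly a b x (n + 2) := by
  rw [orthoPoly]
  field_simp [ha (n + 1)]
  ring

/-- `orthoPoly` as a sequence of polynomials. -/
noncomputable def orthoPolynomial (a b : ℕ → ℝ) : ℕ → ℝ[X]
  | 0 => 1
  | 1 => C (a 0)⁻¹ * (X - C (b 0))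
  | n + 2 => C (a (n + 1))⁻¹ * ((X - C (b (n + 1))) * orthoPolynomial a b (n + 1)
      - C (a n) * orthoPolynomial a b n)

lemma eval_orthoPolynomial (a b : ℕ → ℝ) (x : ℝ) :
    ∀ n, (orthoPolynomial a b n).eval x = orthoPoly a b x n
  | 0 => by simp [orthoPolynomial, orthoPoly]
  | 1 => by simp [orthoPolynomial, orthoPoly, div_eq_inv_mul]
  | n + 2 => by
    simp [orthoPolynomial, orthoPoly, div_eq_inv_mul, eval_orthoPolynomial a b x n,
      eval_orthoPolynomial a b x (n + 1)]

/-- `γₙ = √(Γ(n + p + 1) / (n! Γ(p + 1)))`. -/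
noncomputable def laguerreCoeff (p : ℝ) (n : ℕ) : ℝ :=
  Real.sqrt (Real.Gamma (n + (p + 1)) / (n.factorial * Real.Gamma (p + 1)))

lemma laguerreCoeff_zero {p : ℝ} (hp : -1 < p) : laguerreCoeff p 0 = 1 := by
  have : Real.Gamma (p + 1) ≠ 0 := (Real.Gamma_pos_of_pos (by linarith)).ne'
  simp [laguerreCoeff, this]

/-- This relation and `laguerreA_mul_laguerreCoeff` are all that the Schrödinger equation for the
amplitudes needs to know about `γₙ`. -/
lemma laguerreA_mul_laguerreCoeff_succ {p : ℝ} (hp : -1 < p) (n : ℕ) :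
    laguerreA p n * laguerreCoeff p (n + 1) = (n + 1 + p) * laguerreCoeff p n := by
  have h0 : (0 : ℝ) ≤ n := n.cast_nonneg
  have h1 : 0 < (n : ℝ) + 1 + p := by linarith
  have hG : 0 < Real.Gamma (p + 1) := Real.Gamma_pos_of_pos (by linarith)
  have hG' : Real.Gamma (((n + 1 : ℕ) : ℝ) + (p + 1)) = (n + 1 + p) * Real.Gamma (n + (p + 1)) := by
    rw [show (((n + 1 : ℕ) : ℝ) + (p + 1)) = (n + (p + 1)) + 1 by push_cast; ring,
      Real.Gamma_add_one (by linarith)]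
    ring
  rw [laguerreA, laguerreCoeff, laguerreCoeff, hG', ← Real.sqrt_mul (by positivity)]
  rw [← Real.sqrt_sq h1.le, ← Real.sqrt_mul (sq_nonneg _), Real.sqrt_sq h1.le,
    Nat.factorial_succ]
  congr 1
  push_cast
  field_simp

lemma laguerreA_mul_laguerreCoeff {p : ℝ} (hp : -1 < p) (n : ℕ) :
    laguerreA p n * laguerreCoeff p n = (n + 1) * laguerreCoeff p (n + 1) := by
  have h0 : (0 : ℝ) ≤ n := n.cast_nonneg
  have h1 : (n : ℝ) + 1 + p ≠ 0 := by linarith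
  have h2 := laguerreA_mul_laguerreCoeff_succ hp n
  have h3 := laguerreA_sq hp n
  refine mul_left_cancel₀ h1 ?_
  calc _ = laguerreA p n * ((n + 1 + p) * laguerreCoeff p n) := by ring
    _ = laguerreA p n ^ 2 * laguerreCoeff p (n + 1) := by rw [← h2]; ring
    _ = _ := by rw [h3]; ring

/-- The transform `∫ P(x) e ^ (-itx) dν_p(x)` of a polynomial. -/
noncomputable def laguerreFourier (p : ℝ) (P : ℝ[X]) (t : ℝ) : ℂ :=
  ∫ x, ((P.eval x : ℝ) : ℂ) * Complex.exp (-(Complex.I * t * x)) ∂laguerreMeasure p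

lemma laguerreFourier_add {p : ℝ} (hp : -1 < p) (P Q : ℝ[X]) (t : ℝ) :
    laguerreFourier p (P + Q) t = laguerreFourier p P t + laguerreFourier p Q t := by
  rw [laguerreFourier, laguerreFourier, laguerreFourier,
    ← integral_add (integrable_eval_mul_exp hp _ _) (integrable_eval_mul_exp hp _ _)]
  simp [add_mul]

lemma laguerreFourier_C_mul (p c : ℝ) (P : ℝ[X]) (t : ℝ) :
    laguerreFourier p (C c * P) t = c * laguerreFourier p P t := by
  rw [laguerreFourier, laguerreFourier, ← integral_const_mul]
  simp [mul_assoc]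

lemma hasDerivAt_laguerreFourier {p : ℝ} (hp : -1 < p) (P : ℝ[X]) (t : ℝ) :
    HasDerivAt (laguerreFourier p P) (-Complex.I * laguerreFourier p (X * P) t) t :=
  hasDerivAt_integral_eval_mul_exp hp P t

lemma laguerreFourier_one {p : ℝ} (hp : -1 < p) (t : ℝ) :
    laguerreFourier p 1 t = (1 + Complex.I * t) ^ (-((p : ℂ) + 1)) := by
  have := complexMGF_laguerreMeasure hp (z := -(Complex.I * t)) (by simp)
  rw [sub_neg_eq_add] at this
  rw [← this, laguerreFourier, ProbabilityTheory.complexMGF]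
  simp

lemma one_add_I_mul_mem_slitPlane (t : ℝ) : 1 + Complex.I * t ∈ Complex.slitPlane :=
  Or.inl (by simp)

lemma one_add_I_mul_ne_zero (t : ℝ) : 1 + Complex.I * t ≠ 0 :=
  Complex.slitPlane_ne_zero (one_add_I_mul_mem_slitPlane t)

/-- The explicit value `γₙ (1 + it) ^ (-p - 1) (-it / (1 + it)) ^ n` of the matrix element
`⟨eₙ, e ^ (-itJ) e₀⟩`. -/
noncomputable def laguerreAmplitude (p : ℝ) (n : ℕ) (t : ℝ) : ℂ :=
  laguerreCoeff p n * ((1 + Complex.I * t) ^ (-((p : ℂ) + 1))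
    * (-(Complex.I * t) / (1 + Complex.I * t)) ^ n)

lemma hasDerivAt_one_add_I_mul_cpow (c : ℂ) (t : ℝ) :
    HasDerivAt (fun t : ℝ => (1 + Complex.I * (t : ℂ)) ^ c)
      (c * (1 + Complex.I * t) ^ c * (1 + Complex.I * t)⁻¹ * Complex.I) t := by
  have h1 : HasDerivAt (fun z : ℂ => 1 + Complex.I * z) Complex.I (t : ℂ) := by
    simpa using ((hasDerivAt_id (t : ℂ)).const_mul Complex.I).const_add 1
  refine (h1.cpow_const (c := c) (one_add_I_mul_mem_slitPlane t)).comp_ofReal.congr_deriv ?_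
  rw [Complex.cpow_sub _ _ (one_add_I_mul_ne_zero t), Complex.cpow_one]
  ring

lemma neg_I_mul_div (t : ℝ) :
    -(Complex.I * t) / (1 + Complex.I * t) = (1 + Complex.I * t)⁻¹ - 1 := by
  have := one_add_I_mul_ne_zero t
  field_simp
  ring

lemma hasDerivAt_laguerreAmplitude_zero {p : ℝ} (hp : -1 < p) (t : ℝ) :
    HasDerivAt (laguerreAmplitude p 0) (-Complex.I * (laguerreB p 0 * laguerreAmplitude p 0 t
      + laguerreA p 0 * laguerreAmplitude p 1 t)) t := by
  have h2 := (hasDerivAt_one_add_I_mul_cpow (-((p : ℂ) + 1)) t).const_mul (laguerreCoeff p 0 : ℂ)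
  have h3 : (laguerreA p 0 : ℂ) * laguerreCoeff p 1 = (1 + p) * laguerreCoeff p 0 := by
    exact_mod_cast (by simpa using laguerreA_mul_laguerreCoeff_succ hp 0)
  refine (h2.congr_of_eventuallyEq (Eventually.of_forall fun s => ?_)).congr_deriv ?_
  · simp [laguerreAmplitude]
  · simp only [laguerreAmplitude, laguerreB, neg_I_mul_div]
    push_cast
    linear_combination (Complex.I * ((1 + Complex.I * t) ^ (-((p : ℂ) + 1))
      * ((1 + Complex.I * t)⁻¹ - 1))) * h3

/-- Put `v = 1/(1+it)` and `w = v - 1`, so that `w' = -iv²`. The derivative of `(1+it)^(-p-1)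
w^(n+1)` is `-i(1+it)^(-p-1) wⁿ` times `(p+1)(w+1)w + (n+1)(w+1)²`, that is, `(n+1) + (2n+p+3)w +
(n+2+p)w²`. The outer coefficients match the off-diagonal entries through the two relations for
`γₙ`. -/
lemma hasDerivAt_laguerreAmplitude_succ {p : ℝ} (hp : -1 < p) (n : ℕ) (t : ℝ) :
    HasDerivAt (laguerreAmplitude p (n + 1)) (-Complex.I * (laguerreA p n * laguerreAmplitude p n t
      + laguerreB p (n + 1) * laguerreAmplitude p (n + 1) t
      + laguerreA p (n + 1) * laguerreAmplitude p (n + 2) t)) t := by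
  have h1 : HasDerivAt (fun t : ℝ => (1 + Complex.I * (t : ℂ))⁻¹ - 1)
      (-Complex.I / (1 + Complex.I * t) ^ 2) t := by
    have h : HasDerivAt (fun t : ℝ => 1 + Complex.I * (t : ℂ)) Complex.I t := by
      simpa using (((hasDerivAt_id (t : ℂ)).const_mul Complex.I).const_add 1).comp_ofReal
    exact (h.fun_inv (one_add_I_mul_ne_zero t)).sub_const 1
  have h2 := ((hasDerivAt_one_add_I_mul_cpow (-((p : ℂ) + 1)) t).mul
    (h1.pow (n + 1))).const_mul (laguerreCoeff p (n + 1) : ℂ)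
  have h3 : (laguerreA p (n + 1) : ℂ) * laguerreCoeff p (n + 2)
      = (n + 2 + p) * laguerreCoeff p (n + 1) := by
    have := laguerreA_mul_laguerreCoeff_succ hp (n + 1)
    push_cast at this
    rw [show (n : ℝ) + 1 + 1 + p = n + 2 + p by ring] at this
    exact_mod_cast this
  have h4 : (laguerreA p n : ℂ) * laguerreCoeff p n = (n + 1) * laguerreCoeff p (n + 1) := by
    exact_mod_cast laguerreA_mul_laguerreCoeff hp n
  refine (h2.congr_of_eventuallyEq (Eventually.of_forall fun s => ?_)).congr_deriv ?_
  · simp [laguerreAmplitude, neg_I_mul_div]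
  · simp only [laguerreAmplitude, laguerreB, neg_I_mul_div]
    simp only [div_eq_mul_inv, ← inv_pow, Nat.add_sub_cancel, Pi.pow_apply]
    push_cast
    generalize (1 + Complex.I * (t : ℂ)) ^ (-((p : ℂ) + 1)) = u
    generalize (1 + Complex.I * (t : ℂ))⁻¹ = v
    linear_combination (Complex.I * u * (v - 1) ^ (n + 2)) * h3
      + (Complex.I * u * (v - 1) ^ n) * h4

/-- The transform of `X * P` is `i` times the derivative of that of `P`. As the amplitudes obey the
same three-term relation in terms of their derivatives, the recurrence carries the equality from the
lower indices to the next one. -/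
lemma laguerreFourier_orthoPolynomial {p : ℝ} (hp : -1 < p) (n : ℕ) (t : ℝ) :
    laguerreFourier p (orthoPolynomial (laguerreA p) (laguerreB p) n) t
      = laguerreAmplitude p n t := by
  have ha : ∀ n, (laguerreA p n : ℂ) ≠ 0 := fun n =>
    Complex.ofReal_ne_zero.2 (laguerreA_pos hp n).ne'
  induction n using Nat.strong_induction_on generalizing t with
  | _ n ih =>
    match n, ih with
    | 0, _ =>
      simp [orthoPolynomial, laguerreFourier_one hp, laguerreAmplitude, laguerreCoeff_zero hp]
    | 1, ih =>
      have h0 : laguerreFourier p 1 = laguerreAmplitude p 0 := funext fun t => ih 0 (by norm_num) t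
      have h1 := hasDerivAt_laguerreFourier hp 1 t
      rw [h0] at h1
      have h2 := h1.unique (hasDerivAt_laguerreAmplitude_zero hp t)
      have h3 := mul_left_cancel₀ (neg_ne_zero.2 Complex.I_ne_zero) h2
      rw [orthoPolynomial, sub_eq_add_neg, ← C_neg, ← mul_one (C (-laguerreB p 0)), ← mul_one X,
        laguerreFourier_C_mul, laguerreFourier_add hp, laguerreFourier_C_mul, mul_one, h0,
        ← mul_one X, h3]
      push_cast
      field_simp [ha 0]
      ring
    | n + 2, ih =>
      set P := orthoPolynomial (laguerreA p) (laguerreB p) with hP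
      have h0 : laguerreFourier p (P (n + 1)) = laguerreAmplitude p (n + 1) :=
        funext fun t => ih (n + 1) (by omega) t
      have h1 := hasDerivAt_laguerreFourier hp (P (n + 1)) t
      rw [h0] at h1
      have h2 := h1.unique (hasDerivAt_laguerreAmplitude_succ hp n t)
      have h3 := mul_left_cancel₀ (neg_ne_zero.2 Complex.I_ne_zero) h2
      have h4 : P (n + 2) = C (laguerreA p (n + 1))⁻¹ * (X * P (n + 1)
          + (C (-laguerreB p (n + 1)) * P (n + 1) + C (-laguerreA p n) * P n)) := by
        rw [hP, orthoPolynomial]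
        simp only [C_neg]
        ring
      rw [h4, laguerreFourier_C_mul, laguerreFourier_add hp, laguerreFourier_add hp,
        laguerreFourier_C_mul, laguerreFourier_C_mul, h3, h0, ih n (by omega)]
      push_cast
      field_simp [ha (n + 1)]
      ring

/-- The last four hypotheses say entrywise that `J M = M Jᵀ`. Since the `aₙ` do not vanish, this
determines each row of `M` from the preceding ones, and the identity matrix is the solution with the
prescribed row 0. -/
lemma orthonormal_of_recurrence {a b : ℕ → ℝ} (ha : ∀ n, a n ≠ 0) {M : ℕ → ℕ → ℝ}
    (hM : ∀ n, M 0 n = if n = 0 then 1 else 0)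
    (h00 : b 0 * M 0 0 + a 0 * M 1 0 = b 0 * M 0 0 + a 0 * M 0 1)
    (h0s : ∀ n, b 0 * M 0 (n + 1) + a 0 * M 1 (n + 1)
      = a n * M 0 n + b (n + 1) * M 0 (n + 1) + a (n + 1) * M 0 (n + 2))
    (hs0 : ∀ m, a m * M m 0 + b (m + 1) * M (m + 1) 0 + a (m + 1) * M (m + 2) 0
      = b 0 * M (m + 1) 0 + a 0 * M (m + 1) 1)
    (hss : ∀ m n, a m * M m (n + 1) + b (m + 1) * M (m + 1) (n + 1) + a (m + 1) * M (m + 2) (n + 1)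
      = a n * M (m + 1) n + b (n + 1) * M (m + 1) (n + 1) + a (n + 1) * M (m + 1) (n + 2)) :
    ∀ m n, M m n = if m = n then 1 else 0 := by
  intro m
  induction m using Nat.strong_induction_on with
  | _ m ih =>
    match m, ih with
    | 0, _ => intro n; rw [hM]; simp [eq_comm]
    | 1, ih =>
      intro n
      refine mul_left_cancel₀ (ha 0) ?_
      match n with
      | 0 => simp_all
      | 1 => have := h0s 0; simp_all
      | n + 2 => have := h0s (n + 1); simp_all
    | m + 2, ih =>
      intro n
      refine mul_left_cancel₀ (ha (m + 1)) ?_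
      have i1 := ih (m + 1) (by omega)
      have i0 := ih m (by omega)
      match n with
      | 0 =>
        have := hs0 m
        simp only [i1, i0] at this ⊢
        rcases m with _ | m <;> simp_all
      | n + 1 =>
        have := hss m n
        simp only [i1, i0] at this ⊢
        by_cases e1 : m = n + 1
        · subst e1
          have : n + 1 + 1 ≠ n := by omega
          simp_all
        by_cases e2 : m = n
        · subst e2; simp_all
        by_cases e3 : m + 1 = n
        · subst e3; simp_all
        simp_all

lemma X_mul_orthoPolynomial_zero {a b : ℕ → ℝ} (ha : ∀ n, a n ≠ 0) :
    X * orthoPolynomial a b 0 = C (b 0) * orthoPolynomial a b 0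
      + C (a 0) * orthoPolynomial a b 1 := by
  rw [orthoPolynomial, orthoPolynomial, ← mul_assoc, ← C_mul, mul_inv_cancel₀ (ha 0), C_1]
  ring

lemma X_mul_orthoPolynomial_succ {a b : ℕ → ℝ} (ha : ∀ n, a n ≠ 0) (n : ℕ) :
    X * orthoPolynomial a b (n + 1) = C (a n) * orthoPolynomial a b n
      + C (b (n + 1)) * orthoPolynomial a b (n + 1)
      + C (a (n + 1)) * orthoPolynomial a b (n + 2) := by
  rw [orthoPolynomial, ← mul_assoc (C (a (n + 1))), ← C_mul, mul_inv_cancel₀ (ha (n + 1)), C_1]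
  ring

lemma integrable_eval_laguerreMeasure {p : ℝ} (hp : -1 < p) (P : ℝ[X]) :
    Integrable (fun x => P.eval x) (laguerreMeasure p) := by
  simpa using (integrable_eval_mul_exp hp P 0).re

lemma ofReal_integral_eval_laguerreMeasure (p : ℝ) (P : ℝ[X]) :
    ((∫ x, P.eval x ∂laguerreMeasure p : ℝ) : ℂ) = laguerreFourier p P 0 := by
  rw [laguerreFourier, ← integral_complex_ofReal]
  simp

/-- Multiplication by `X` is symmetric for the moment functional, which supplies the recurrence
hypotheses; row 0 is read off from the amplitudes at `t = 0`, where `w = 0`. -/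
lemma integral_orthoPolynomial_mul {p : ℝ} (hp : -1 < p) (m n : ℕ) :
    ∫ x, (orthoPolynomial (laguerreA p) (laguerreB p) m).eval x
      * (orthoPolynomial (laguerreA p) (laguerreB p) n).eval x ∂laguerreMeasure p
      = if m = n then 1 else 0 := by
  have ha : ∀ n, laguerreA p n ≠ 0 := fun n => (laguerreA_pos hp n).ne'
  set P := orthoPolynomial (laguerreA p) (laguerreB p)
  let I : ℝ[X] → ℝ := fun Q => ∫ x, Q.eval x ∂laguerreMeasure p
  have hadd : ∀ Q R, I (Q + R) = I Q + I R := fun Q R => by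
    simp only [I, eval_add]
    exact integral_add (integrable_eval_laguerreMeasure hp _) (integrable_eval_laguerreMeasure hp _)
  have hmul : ∀ c Q, I (C c * Q) = c * I Q := fun c Q => by
    simp only [I, eval_mul, eval_C]
    exact integral_const_mul _ _
  have h0 : ∀ R, I (X * P 0 * R) = laguerreB p 0 * I (P 0 * R) + laguerreA p 0 * I (P 1 * R) :=
    fun R => by
      rw [X_mul_orthoPolynomial_zero ha, add_mul, hadd, mul_assoc, mul_assoc, hmul, hmul]
  have hs : ∀ n R, I (X * P (n + 1) * R) = laguerreA p n * I (P n * R)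
      + laguerreB p (n + 1) * I (P (n + 1) * R) + laguerreA p (n + 1) * I (P (n + 2) * R) :=
    fun n R => by
      rw [X_mul_orthoPolynomial_succ ha, add_mul, add_mul, hadd, hadd, mul_assoc, mul_assoc,
        mul_assoc, hmul, hmul, hmul]
  have hcomm : ∀ Q R, I (Q * R) = I (R * Q) := fun Q R => by rw [mul_comm]
  have hX : ∀ Q R, I (X * Q * R) = I (X * R * Q) := fun Q R => by
    rw [mul_assoc, mul_comm Q R, mul_assoc]
  have key := orthonormal_of_recurrence (a := laguerreA p) (b := laguerreB p) ha
    (M := fun m n => I (P m * P n)) ?_ ?_ ?_ ?_ ?_ m n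
  · simpa [I] using key
  · intro n
    have h1 : I (P 0 * P n) = ∫ x, (P n).eval x ∂laguerreMeasure p := by
      simp [I, P, orthoPolynomial]
    rw [h1, ← Complex.ofReal_inj, ofReal_integral_eval_laguerreMeasure,
      laguerreFourier_orthoPolynomial hp]
    rcases n with _ | n <;> simp [laguerreAmplitude, laguerreCoeff_zero hp]
  · simp only [hcomm (P 1) (P 0)]
  · intro n
    have := (h0 (P (n + 1))).symm.trans (hX _ _)
    rw [hs] at this
    simpa only [hcomm _ (P 0)] using this
  · intro m
    have := (hs m (P 0)).symm.trans (hX _ _)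
    rw [h0] at this
    simpa only [hcomm (P 0) (P (m + 1)), hcomm (P 1) (P (m + 1))] using this
  · intro m n
    have := (hs m (P (n + 1))).symm.trans (hX _ _)
    rw [hs] at this
    simpa only [hcomm _ (P (m + 1))] using this

end Polynomials

/-! ### Uniqueness of Fourier transforms of integrable functions -/

/-- The positive and negative parts of `k` are densities of finite measures with equal
characteristic functions, so the measures and then the densities coincide. -/
lemma ae_eq_zero_of_integral_exp_mul_eq_zero_real {μ : Measure ℝ} {k : ℝ → ℝ} (hk : Integrable k μ)
    (h : ∀ t : ℝ, ∫ x, Complex.exp (t * x * Complex.I) * (k x : ℂ) ∂μ = 0) : k =ᵐ[μ] 0 := by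
  have h1 : ∀ g : ℝ → ℝ, Integrable g μ →
      IsFiniteMeasure (μ.withDensity fun x => ENNReal.ofReal (g x)) ∧
      ∀ t : ℝ, charFun (μ.withDensity fun x => ENNReal.ofReal (g x)) t
        = ∫ x, Complex.exp (t * x * Complex.I) * ((max (g x) 0 : ℝ) : ℂ) ∂μ := by
    intro g hg
    refine ⟨isFiniteMeasure_withDensity_ofReal hg.2, fun t => ?_⟩
    rw [charFun_apply_real, integral_withDensity_eq_integral_toReal_smul₀
      hg.aestronglyMeasurable.aemeasurable.ennreal_ofReal (by simp)]
    simp [ENNReal.toReal_ofReal', mul_comm]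
  obtain ⟨hf1, hc1⟩ := h1 k hk
  obtain ⟨hf2, hc2⟩ := h1 (fun x => -k x) hk.neg
  have hint : ∀ t : ℝ, ∀ g : ℝ → ℝ, Integrable g μ →
      Integrable (fun x : ℝ => Complex.exp (t * x * Complex.I) * ((max (g x) 0 : ℝ) : ℂ)) μ := by
    intro t g hg
    refine (hg.pos_part.ofReal (𝕜 := ℂ)).bdd_mul (c := 1) (by fun_prop)
      (Eventually.of_forall fun x => ?_)
    have := Complex.norm_exp_ofReal_mul_I (t * x)
    push_cast at this
    exact this.le
  have heq : (μ.withDensity fun x => ENNReal.ofReal (k x))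
      = μ.withDensity fun x => ENNReal.ofReal (-k x) := by
    refine Measure.ext_of_charFun (funext fun t => ?_)
    rw [hc1, hc2, ← sub_eq_zero, ← integral_sub (hint t k hk) (hint t (fun x => -k x) hk.neg),
      ← h t]
    congr 1
    funext x
    rw [← mul_sub, ← Complex.ofReal_sub]
    rcases le_total 0 (k x) with hx | hx <;> simp [hx]
  replace heq := (withDensity_eq_iff hk.aestronglyMeasurable.aemeasurable.ennreal_ofReal
    hk.neg.aestronglyMeasurable.aemeasurable.ennreal_ofReal hk.lintegral_lt_top.ne).1 heq
  filter_upwards [heq] with x hx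
  simp only [Pi.neg_apply] at hx
  -- The two parts never are positive at the same point, so their equality forces both to vanish.
  rcases lt_trichotomy (k x) 0 with h0 | h0 | h0
  · rw [ENNReal.ofReal_of_nonpos h0.le, eq_comm, ENNReal.ofReal_eq_zero] at hx
    simp only [Pi.zero_apply]; linarith
  · exact h0
  · rw [ENNReal.ofReal_of_nonpos (p := -k x) (by linarith), ENNReal.ofReal_eq_zero] at hx
    simp only [Pi.zero_apply]; linarith

/-- Conjugating the hypothesis at `-t` gives it for the conjugate of `k`, hence for the real and
imaginary parts. -/
lemma ae_eq_zero_of_integral_exp_mul_eq_zero {μ : Measure ℝ} {k : ℝ → ℂ} (hk : Integrable k μ)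
    (h : ∀ t : ℝ, ∫ x, Complex.exp (t * x * Complex.I) * k x ∂μ = 0) : k =ᵐ[μ] 0 := by
  have hexp : ∀ t x : ℝ, ‖Complex.exp (t * x * Complex.I)‖ ≤ 1 := fun t x => by
    have := Complex.norm_exp_ofReal_mul_I (t * x)
    push_cast at this
    exact this.le
  have hconj : ∀ t x : ℝ, (starRingEnd ℂ) (Complex.exp (((-t : ℝ) : ℂ) * x * Complex.I))
      = Complex.exp (t * x * Complex.I) := fun t x => by
    rw [← Complex.exp_conj]
    simp
  have hint : ∀ t : ℝ, Integrable (fun x : ℝ => Complex.exp (t * x * Complex.I) * k x) μ := fun t =>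
    hk.bdd_mul (c := 1) (by fun_prop) (Eventually.of_forall fun x => hexp t x)
  have hint' : ∀ t : ℝ, Integrable (fun x : ℝ => Complex.exp (t * x * Complex.I)
      * (starRingEnd ℂ) (k x)) μ := fun t => by
    have := (Complex.conjLIE.integrable_comp_iff (φ := k) (μ := μ)).2 hk
    exact this.bdd_mul (c := 1) (by fun_prop) (Eventually.of_forall fun x => hexp t x)
  have h' : ∀ t : ℝ, ∫ x, Complex.exp (t * x * Complex.I) * (starRingEnd ℂ) (k x) ∂μ = 0 := by
    intro t
    have := congrArg (starRingEnd ℂ) (h (-t))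
    rw [← integral_conj, map_zero] at this
    simpa only [map_mul, hconj] using this
  have hre := ae_eq_zero_of_integral_exp_mul_eq_zero_real hk.re fun t => by
    have h2 : (fun x : ℝ => Complex.exp (t * x * Complex.I) * ((RCLike.re (k x) : ℝ) : ℂ))
        = fun x : ℝ => (2⁻¹ : ℂ) * (Complex.exp (t * x * Complex.I) * k x
          + Complex.exp (t * x * Complex.I) * (starRingEnd ℂ) (k x)) := by
      funext x
      rw [← mul_add, Complex.add_conj]
      simp only [RCLike.re_to_complex]
      push_cast
      ring
    rw [h2, integral_const_mul, integral_add (hint t) (hint' t), h, h', add_zero, mul_zero]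
  have him := ae_eq_zero_of_integral_exp_mul_eq_zero_real hk.im fun t => by
    have h2 : (fun x : ℝ => Complex.exp (t * x * Complex.I) * ((RCLike.im (k x) : ℝ) : ℂ))
        = fun x : ℝ => (-Complex.I * 2⁻¹ : ℂ) * (Complex.exp (t * x * Complex.I) * k x
          - Complex.exp (t * x * Complex.I) * (starRingEnd ℂ) (k x)) := by
      funext x
      rw [← mul_sub, Complex.sub_conj]
      have := Complex.I_mul_I
      simp only [RCLike.im_to_complex]
      push_cast
      linear_combination (Complex.exp (t * x * Complex.I) * (k x).im) * this
    rw [h2, integral_const_mul, integral_sub (hint t) (hint' t), h, h', sub_zero, mul_zero]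
  filter_upwards [hre, him] with x h1 h2
  exact Complex.ext h1 h2

/-! ### Multiplication by `e^(-itx)` and dominated convergence in `L²` -/

lemma norm_exp_neg_I_mul (t x : ℝ) : ‖Complex.exp (-(Complex.I * t * x))‖ = 1 := by
  rw [show -(Complex.I * t * x) = ((-(t * x) : ℝ) : ℂ) * Complex.I by push_cast; ring,
    Complex.norm_exp_ofReal_mul_I]

lemma memLp_exp_mul (t : ℝ) (F : LTwoPos) :
    MemLp (fun x : ℝ => Complex.exp (-(Complex.I * t * x)) * (F : ℝ → ℂ) x) 2
      (volume.restrict (Set.Ioi (0 : ℝ))) := by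
  refine (Lp.memLp F).of_le ?_ (Eventually.of_forall fun x => ?_)
  · exact (by fun_prop : Continuous fun x : ℝ => Complex.exp (-(Complex.I * t * x)))
      |>.aestronglyMeasurable.mul (Lp.aestronglyMeasurable F)
  · rw [norm_mul, norm_exp_neg_I_mul, one_mul]

/-- Multiplication by `e ^ (-itx)` on `L²(ℝ₊)`. -/
noncomputable def mulExp (t : ℝ) : LTwoPos →ₗᵢ[ℂ] LTwoPos where
  toFun F := (memLp_exp_mul t F).toLp _
  map_add' F G := by
    rw [← MemLp.toLp_add]
    refine MemLp.toLp_congr _ _ ?_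
    filter_upwards [Lp.coeFn_add F G] with x hx
    rw [hx, Pi.add_apply, Pi.add_apply, mul_add]
  map_smul' c F := by
    rw [RingHom.id_apply, ← MemLp.toLp_const_smul]
    refine MemLp.toLp_congr _ _ ?_
    filter_upwards [Lp.coeFn_smul c F] with x hx
    rw [hx, Pi.smul_apply, Pi.smul_apply, smul_eq_mul, smul_eq_mul, mul_left_comm]
  norm_map' F := by
    change ‖(memLp_exp_mul t F).toLp _‖ = ‖F‖
    rw [Lp.norm_toLp, Lp.norm_def]
    congr 1
    refine eLpNorm_congr_norm_ae (Eventually.of_forall fun x => ?_)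
    rw [norm_mul, norm_exp_neg_I_mul, one_mul]

lemma coeFn_mulExp (t : ℝ) (F : LTwoPos) :
    (mulExp t F : ℝ → ℂ) =ᵐ[volume.restrict (Set.Ioi (0 : ℝ))]
      fun x => Complex.exp (-(Complex.I * t * x)) * (F : ℝ → ℂ) x :=
  (memLp_exp_mul t F).coeFn_toLp

lemma mulExp_zero (F : LTwoPos) : mulExp 0 F = F := by
  refine Lp.ext ?_
  filter_upwards [coeFn_mulExp 0 F] with x hx
  rw [hx]
  simp

lemma mulExp_add (s t : ℝ) (F : LTwoPos) : mulExp (s + t) F = mulExp s (mulExp t F) := by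
  refine Lp.ext ?_
  filter_upwards [coeFn_mulExp (s + t) F, coeFn_mulExp s (mulExp t F), coeFn_mulExp t F]
    with x h1 h2 h3
  rw [h1, h2, h3, ← mul_assoc, ← Complex.exp_add]
  push_cast
  ring_nf

/-- Multiplication by `e ^ (-itx)` as a unitary operator. -/
noncomputable def mulExpEquiv (t : ℝ) : LTwoPos ≃ₗᵢ[ℂ] LTwoPos :=
  { mulExp t with
    invFun := mulExp (-t)
    left_inv := fun F => by
      change mulExp (-t) (mulExp t F) = F
      rw [← mulExp_add, neg_add_cancel, mulExp_zero]
    right_inv := fun F => by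
      change mulExp t (mulExp (-t) F) = F
      rw [← mulExp_add, add_neg_cancel, mulExp_zero] }

/-- Dominated convergence for the squared distance. The function `f` fixes representatives of all
the classes `F t`, so that pointwise limits along an uncountable parameter make sense. -/
lemma tendsto_lp_two_of_dominated {l : Filter ℝ} [l.IsCountablyGenerated]
    {F : ℝ → LTwoPos} {G : LTwoPos} {f : ℝ → ℝ → ℂ} (D : ℝ → ℝ)
    (hf : ∀ t, (F t : ℝ → ℂ) =ᵐ[volume.restrict (Set.Ioi (0 : ℝ))] f t)
    (hD : MemLp D 2 (volume.restrict (Set.Ioi (0 : ℝ))))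
    (hb : ∀ᶠ t in l, ∀ᵐ x ∂volume.restrict (Set.Ioi (0 : ℝ)), ‖f t x - (G : ℝ → ℂ) x‖ ≤ D x)
    (hl : ∀ᵐ x ∂volume.restrict (Set.Ioi (0 : ℝ)),
      Tendsto (fun t => f t x) l (𝓝 ((G : ℝ → ℂ) x))) :
    Tendsto F l (𝓝 G) := by
  rw [Lp.tendsto_Lp_iff_tendsto_eLpNorm']
  have hfG : ∀ t, (F t : ℝ → ℂ) - (G : ℝ → ℂ) =ᵐ[volume.restrict (Set.Ioi (0 : ℝ))]
      fun x => f t x - (G : ℝ → ℂ) x := fun t => (hf t).sub (ae_eq_refl _)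
  have h2 : Tendsto (fun t => ∫⁻ x in Set.Ioi (0 : ℝ), ‖f t x - (G : ℝ → ℂ) x‖ₑ ^ (2 : ℝ)) l
      (𝓝 (∫⁻ _ in Set.Ioi (0 : ℝ), 0)) := by
    refine tendsto_lintegral_filter_of_dominated_convergence' (fun x => ‖D x‖ₑ ^ (2 : ℝ))
      (Eventually.of_forall fun t => ?_) ?_ ?_ ?_
    · exact ((((Lp.aestronglyMeasurable (F t)).sub (Lp.aestronglyMeasurable G)).congr
        (hfG t)).enorm).pow_const _
    · filter_upwards [hb] with t ht
      filter_upwards [ht] with x hx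
      refine ENNReal.rpow_le_rpow ?_ (by norm_num)
      rw [enorm_le_iff_norm_le]
      exact hx.trans (Real.le_norm_self _)
    · have := hD.2
      rw [eLpNorm_lt_top_iff_lintegral_rpow_enorm_lt_top (by norm_num) (by norm_num)] at this
      simpa using this.ne
    · filter_upwards [hl] with x hx
      have h3 : Tendsto (fun t => ‖f t x - (G : ℝ → ℂ) x‖ₑ) l (𝓝 0) := by
        have h4 := (tendsto_sub_nhds_zero_iff.2 hx).enorm
        simpa using h4
      simpa using h3.ennrpow_const (2 : ℝ)
  rw [lintegral_zero] at h2
  simp_rw [fun t => eLpNorm_congr_ae (p := 2) (hfG t),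
    eLpNorm_eq_lintegral_rpow_enorm_toReal (p := 2) (by norm_num) (by norm_num)]
  simpa using h2.ennrpow_const (1 / 2 : ℝ)

/-! ### Laguerre functions in `L²` and the orbit of the ground state -/

lemma aestronglyMeasurable_laguerreFun (p : ℝ) (n : ℕ) :
    AEStronglyMeasurable (fun x => (laguerreFun p n x : ℂ))
      (volume.restrict (Set.Ioi (0 : ℝ))) := by
  refine Measurable.aestronglyMeasurable (Complex.measurable_ofReal.comp ?_)
  refine Measurable.mul (measurable_laguerreDensity p).sqrt ?_
  simp_rw [← eval_orthoPolynomial]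
  exact (Polynomial.continuous _).measurable

lemma laguerreFun_mul_laguerreFun {p x : ℝ} (hp : -1 < p) (hx : 0 < x) (m n : ℕ) :
    laguerreFun p m x * laguerreFun p n x = laguerreDensity p x *
      ((orthoPolynomial (laguerreA p) (laguerreB p) m *
        orthoPolynomial (laguerreA p) (laguerreB p) n).eval x) := by
  rw [Polynomial.eval_mul, eval_orthoPolynomial, eval_orthoPolynomial, laguerreFun, laguerreFun]
  nth_rewrite 3 [← Real.mul_self_sqrt (laguerreDensity_pos hp hx).le]
  ring

lemma memLp_laguerreFun {p : ℝ} (hp : -1 < p) (n : ℕ) :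
    MemLp (fun x => (laguerreFun p n x : ℂ)) 2 (volume.restrict (Set.Ioi (0 : ℝ))) := by
  rw [memLp_two_iff_integrable_sq_norm (aestronglyMeasurable_laguerreFun p n)]
  refine ((integrable_laguerreMeasure hp).1 (integrable_eval_laguerreMeasure hp
    (orthoPolynomial (laguerreA p) (laguerreB p) n *
      orthoPolynomial (laguerreA p) (laguerreB p) n))).congr_fun (fun x hx => ?_) measurableSet_Ioi
  simp only [smul_eq_mul, Complex.norm_real, Real.norm_eq_abs, sq_abs]
  rw [← laguerreFun_mul_laguerreFun hp hx, sq]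

/-- The normalized Laguerre function as an element of `L²(ℝ₊)`. -/
noncomputable def laguerreLp {p : ℝ} (hp : -1 < p) (n : ℕ) : LTwoPos :=
  (memLp_laguerreFun hp n).toLp _

lemma coeFn_laguerreLp {p : ℝ} (hp : -1 < p) (n : ℕ) :
    (laguerreLp hp n : ℝ → ℂ) =ᵐ[volume.restrict (Set.Ioi (0 : ℝ))]
      fun x => (laguerreFun p n x : ℂ) :=
  (memLp_laguerreFun hp n).coeFn_toLp

lemma inner_laguerreLp_left {p : ℝ} (hp : -1 < p) (n : ℕ) (F : LTwoPos) :
    inner ℂ (laguerreLp hp n) F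
      = ∫ x in Set.Ioi (0 : ℝ), (laguerreFun p n x : ℂ) * (F : ℝ → ℂ) x := by
  rw [L2.inner_def]
  refine integral_congr_ae ?_
  filter_upwards [coeFn_laguerreLp hp n] with x hx
  rw [hx, RCLike.inner_apply, Complex.conj_ofReal, mul_comm]

lemma inner_laguerreLp_mulExp {p : ℝ} (hp : -1 < p) (m n : ℕ) (t : ℝ) :
    inner ℂ (laguerreLp hp m) (mulExp t (laguerreLp hp n)) = laguerreFourier p
      (orthoPolynomial (laguerreA p) (laguerreB p) m *
        orthoPolynomial (laguerreA p) (laguerreB p) n) t := by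
  rw [inner_laguerreLp_left, laguerreFourier, integral_laguerreMeasure hp]
  refine integral_congr_ae ?_
  filter_upwards [coeFn_mulExp t (laguerreLp hp n), coeFn_laguerreLp hp n,
    ae_restrict_mem measurableSet_Ioi] with x h1 h2 hx
  rw [h1, h2, mul_left_comm, ← Complex.ofReal_mul, laguerreFun_mul_laguerreFun hp hx,
    Complex.real_smul]
  push_cast
  ring

lemma inner_laguerreLp_mulExp_zero {p : ℝ} (hp : -1 < p) (n : ℕ) (t : ℝ) :
    inner ℂ (laguerreLp hp n) (mulExp t (laguerreLp hp 0)) = laguerreAmplitude p n t := by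
  rw [inner_laguerreLp_mulExp, orthoPolynomial, mul_one, laguerreFourier_orthoPolynomial hp]

lemma orthonormal_laguerreLp {p : ℝ} (hp : -1 < p) : Orthonormal ℂ (laguerreLp hp) := by
  rw [orthonormal_iff_ite]
  intro m n
  have h := inner_laguerreLp_mulExp hp m n 0
  rw [mulExp_zero, ← ofReal_integral_eval_laguerreMeasure] at h
  simp_rw [Polynomial.eval_mul] at h
  rw [h, integral_orthoPolynomial_mul hp]
  split_ifs <;> simp

lemma inner_mulExp_mulExp (s t : ℝ) (F G : LTwoPos) :
    inner ℂ (mulExp s F) (mulExp t G) = inner ℂ F (mulExp (t - s) G) := by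
  rw [← (mulExp s).inner_map_map F, ← mulExp_add, add_sub_cancel]

/-- The product of the two ground states is a constant multiple of the Gamma density with parameter
`(p+q)/2`, whose Fourier transform is known. This identifies the limit of the matrix elements. -/
lemma inner_laguerreLp_zero_mulExp_zero {p q : ℝ} (hp : -1 < p) (hq : -1 < q) (t : ℝ) :
    inner ℂ (laguerreLp hq 0) (mulExp t (laguerreLp hp 0))
      = (Real.Gamma ((p + q) / 2 + 1) / √(Real.Gamma (p + 1) * Real.Gamma (q + 1)) : ℝ)
        * (1 + Complex.I * t) ^ (-((((p + q) / 2 : ℝ) : ℂ) + 1)) := by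
  have hα : -1 < (p + q) / 2 := by linarith
  have hGp : 0 < Real.Gamma (p + 1) := Real.Gamma_pos_of_pos (by linarith)
  have hGq : 0 < Real.Gamma (q + 1) := Real.Gamma_pos_of_pos (by linarith)
  have hG : 0 < Real.Gamma ((p + q) / 2 + 1) := Real.Gamma_pos_of_pos (by linarith)
  rw [inner_laguerreLp_left, ← laguerreFourier_one hα, laguerreFourier,
    integral_laguerreMeasure hα, ← integral_const_mul]
  refine integral_congr_ae ?_
  filter_upwards [coeFn_mulExp t (laguerreLp hp 0), coeFn_laguerreLp hp 0,
    ae_restrict_mem measurableSet_Ioi] with x h1 h2 hx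
  have hx : 0 < x := hx
  have h3 : laguerreFun q 0 x * laguerreFun p 0 x = Real.Gamma ((p + q) / 2 + 1)
      / √(Real.Gamma (p + 1) * Real.Gamma (q + 1)) * laguerreDensity ((p + q) / 2) x := by
    simp only [laguerreFun, orthoPoly, mul_one]
    rw [← Real.sqrt_mul (laguerreDensity_pos hq hx).le, laguerreDensity, laguerreDensity,
      laguerreDensity]
    have h4 : x ^ q * Real.exp (-x) / Real.Gamma (q + 1) *
        (x ^ p * Real.exp (-x) / Real.Gamma (p + 1))
        = (x ^ ((p + q) / 2) * Real.exp (-x)) ^ 2 / (Real.Gamma (p + 1) * Real.Gamma (q + 1)) := by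
      have : x ^ q * x ^ p = (x ^ ((p + q) / 2)) ^ 2 := by
        rw [← Real.rpow_add hx, ← Real.rpow_natCast, ← Real.rpow_mul hx.le]
        congr 1
        push_cast
        ring
      rw [mul_pow, ← this]
      field_simp
    rw [h4, Real.sqrt_div (sq_nonneg _), Real.sqrt_sq (by positivity)]
    generalize Real.Gamma ((p + q) / 2 + 1) = G at hG ⊢
    field_simp
  rw [h1, h2, mul_left_comm, ← Complex.ofReal_mul, h3, Complex.real_smul]
  simp only [Polynomial.eval_one]
  push_cast
  ring

/-- Fourier uniqueness gives `φ₀ F = 0`, and `φ₀` has no zeros on the half-line. -/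
lemma eq_zero_of_inner_mulExp_laguerreLp_eq_zero {p : ℝ} (hp : -1 < p) {F : LTwoPos}
    (h : ∀ t : ℝ, inner ℂ (mulExp t (laguerreLp hp 0)) F = 0) : F = 0 := by
  have hint : Integrable (fun x => (laguerreFun p 0 x : ℂ) * (F : ℝ → ℂ) x)
      (volume.restrict (Set.Ioi (0 : ℝ))) :=
    (memLp_laguerreFun hp 0).integrable_mul (Lp.memLp F)
  have h0 := ae_eq_zero_of_integral_exp_mul_eq_zero hint fun t => by
    rw [← h t, L2.inner_def]
    refine integral_congr_ae ?_
    filter_upwards [coeFn_mulExp t (laguerreLp hp 0), coeFn_laguerreLp hp 0] with x h1 h2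
    rw [h1, h2, RCLike.inner_apply, map_mul, Complex.conj_ofReal, ← Complex.exp_conj]
    simp only [map_neg, map_mul, Complex.conj_I, Complex.conj_ofReal]
    ring_nf
  rw [Lp.eq_zero_iff_ae_eq_zero]
  filter_upwards [h0, ae_restrict_mem measurableSet_Ioi] with x h1 hx
  have : laguerreFun p 0 x ≠ 0 := by
    simp only [laguerreFun, orthoPoly, mul_one]
    exact (Real.sqrt_pos.2 (laguerreDensity_pos hp hx)).ne'
  simpa [this] using h1

/-! ### Gamma function asymptotics and an Abelian theorem -/

lemma ofReal_mul_cpow {r : ℝ} (hr : 0 < r) {z : ℂ} (hz : z ≠ 0) (c : ℂ) :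
    ((r : ℂ) * z) ^ c = (r : ℂ) ^ c * z ^ c := by
  have hr' : (r : ℂ) ≠ 0 := Complex.ofReal_ne_zero.2 hr.ne'
  rw [Complex.cpow_def_of_ne_zero (mul_ne_zero hr' hz), Complex.cpow_def_of_ne_zero hr',
    Complex.cpow_def_of_ne_zero hz, Complex.log_ofReal_mul hr hz, Complex.ofReal_log hr.le,
    add_mul, Complex.exp_add]

lemma Gamma_mul_choose {a : ℝ} (ha : 0 < a) (n : ℕ) :
    (Real.Gamma a : ℂ) * Ring.choose ((a : ℂ) + n - 1) n
      = ((Real.Gamma (n + a) / n.factorial : ℝ) : ℂ) := by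
  have h1 := Ring.factorial_nsmul_multichoose_eq_ascPochhammer (a : ℂ) n
  rw [Ring.multichoose_eq, Polynomial.ascPochhammer_smeval_eq_eval] at h1
  have h2 : (Real.Gamma a : ℂ) * (ascPochhammer ℂ n).eval (a : ℂ) = Real.Gamma (n + a) := by
    clear h1
    induction n with
    | zero => simp
    | succ n ih =>
      rw [ascPochhammer_succ_eval, ← mul_assoc, ih]
      rw [show ((n + 1 : ℕ) : ℝ) + a = (n + a) + 1 by push_cast; ring,
        Real.Gamma_add_one (by positivity)]
      push_cast
      ring
  have hn : (n.factorial : ℂ) ≠ 0 := by exact_mod_cast n.factorial_ne_zero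
  rw [nsmul_eq_mul] at h1
  push_cast
  rw [eq_div_iff hn, ← h2, ← h1]
  ring

lemma hasSum_Gamma_mul_pow {a : ℝ} (ha : 0 < a) {z : ℂ} (hz : ‖z‖ < 1) :
    HasSum (fun n : ℕ => ((Real.Gamma (n + a) / n.factorial : ℝ) : ℂ) * z ^ n)
      (Real.Gamma a * (1 - z) ^ (-(a : ℂ))) := by
  have h := (Complex.one_div_one_sub_cpow_hasFPowerSeriesOnBall_zero (a : ℂ)).hasSum
    (y := z) (by simpa [← ofReal_norm, ENNReal.ofReal_lt_one] using hz)
  have h2 := h.mul_left (Real.Gamma a : ℂ)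
  simp only [zero_add, one_div, ← Complex.cpow_neg] at h2
  convert! h2 using 1
  funext n
  rw [← Gamma_mul_choose ha]
  simp [mul_comm, mul_left_comm]

/-- Euler's limit formula for `Γ(x)`, with the product in its denominator rewritten as
`Γ(n+1+x)/Γ(x)`. -/
lemma tendsto_Gamma_div {x : ℝ} (hx : 0 < x) :
    Tendsto (fun n : ℕ => Real.Gamma (n + x) / (n.factorial * (n : ℝ) ^ (x - 1))) atTop (𝓝 1) := by
  have hG := Real.Gamma_pos_of_pos hx
  have h1 : Tendsto (fun n : ℕ => Real.Gamma x / Real.GammaSeq x n * (n / ((n : ℝ) + x))) atTop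
      (𝓝 (Real.Gamma x / Real.Gamma x * 1)) :=
    (tendsto_const_nhds.div (Real.GammaSeq_tendsto_Gamma x) hG.ne').mul
      (tendsto_natCast_div_add_atTop x)
  rw [div_self hG.ne', mul_one] at h1
  refine h1.congr' ?_
  filter_upwards [eventually_gt_atTop 0] with n hn
  have hn : (0 : ℝ) < n := by exact_mod_cast hn
  have hprod : ∀ m : ℕ, Real.Gamma x * ∏ j ∈ Finset.range m, (x + j) = Real.Gamma (m + x) := by
    intro m
    induction m with
    | zero => simp
    | succ m ih =>
      rw [Finset.prod_range_succ, ← mul_assoc, ih]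
      rw [show ((m + 1 : ℕ) : ℝ) + x = (m + x) + 1 by push_cast; ring,
        Real.Gamma_add_one (by positivity)]
      ring
  have h2 := hprod (n + 1)
  rw [show ((n + 1 : ℕ) : ℝ) + x = (n + x) + 1 by push_cast; ring,
    Real.Gamma_add_one (by positivity)] at h2
  have h3 : (n : ℝ) ^ x = n ^ (x - 1) * n := by
    rw [Real.rpow_sub_one hn.ne']
    field_simp
  have h4 : (0 : ℝ) < n ^ (x - 1) := Real.rpow_pos_of_pos hn _
  have h5 : (0 : ℝ) < n.factorial := by exact_mod_cast n.factorial_pos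
  have h6 : 0 < ∏ j ∈ Finset.range (n + 1), (x + (j : ℝ)) :=
    Finset.prod_pos fun j _ => by positivity
  rw [Real.GammaSeq, h3]
  have h7 : 0 < (n : ℝ) + x := by positivity
  field_simp
  rw [h2]

lemma tendsto_sqrt_Gamma_mul_Gamma_div {x y : ℝ} (hx : 0 < x) (hy : 0 < y) :
    Tendsto (fun n : ℕ => √(Real.Gamma (n + x) * Real.Gamma (n + y)) / Real.Gamma (n + (x + y) / 2))
      atTop (𝓝 1) := by
  have h := (((tendsto_Gamma_div hx).mul (tendsto_Gamma_div hy)).sqrt).div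
    (tendsto_Gamma_div (x := (x + y) / 2) (by positivity)) one_ne_zero
  simp only [mul_one, Real.sqrt_one, div_one] at h
  refine h.congr' ?_
  filter_upwards [eventually_gt_atTop 0] with n hn
  have hn : (0 : ℝ) < n := by exact_mod_cast hn
  have h5 : (0 : ℝ) < n.factorial := by exact_mod_cast n.factorial_pos
  have h4 : (0 : ℝ) < n ^ ((x + y) / 2 - 1) := Real.rpow_pos_of_pos hn _
  have h6 : (n : ℝ) ^ (x - 1) * n ^ (y - 1) = (n ^ ((x + y) / 2 - 1)) ^ 2 := by
    rw [← Real.rpow_add hn, ← Real.rpow_natCast, ← Real.rpow_mul hn.le]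
    congr 1
    push_cast
    ring
  have h7 : 0 < Real.Gamma (n + (x + y) / 2) := Real.Gamma_pos_of_pos (by positivity)
  rw [Pi.div_apply, div_mul_div_comm, mul_mul_mul_comm, h6, ← sq, ← mul_pow,
    Real.sqrt_div (mul_nonneg (Real.Gamma_pos_of_pos (by positivity)).le
      (Real.Gamma_pos_of_pos (by positivity)).le), Real.sqrt_sq (by positivity)]
  generalize Real.Gamma (n + (x + y) / 2) = G at h7 ⊢
  generalize (n : ℝ) ^ ((x + y) / 2 - 1) = R at h4 ⊢
  field_simp

/-- The first `N` terms are bounded using `‖z‖ < 1`; the tail is dominated by the binomial series at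
`‖z‖`. -/
lemma norm_tsum_le_of_abs_le {a ε : ℝ} (ha : 0 < a) (hε : 0 ≤ ε) {r : ℕ → ℝ} {N : ℕ}
    (hr : ∀ n, N ≤ n → |r n| ≤ ε * (Real.Gamma (n + a) / n.factorial)) {z S : ℂ} (hz : ‖z‖ < 1)
    (hS : HasSum (fun n => (r n : ℂ) * z ^ n) S) :
    ‖S‖ ≤ ∑ n ∈ Finset.range N, |r n| + ε * (Real.Gamma a * (1 - ‖z‖) ^ (-a)) := by
  have h1 : HasSum (fun n : ℕ => Real.Gamma (n + a) / n.factorial * ‖z‖ ^ n)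
      (Real.Gamma a * (1 - ‖z‖) ^ (-a)) := by
    have := hasSum_Gamma_mul_pow ha (z := (‖z‖ : ℂ)) (by simpa using hz)
    rw [← Complex.hasSum_ofReal]
    convert! this using 1
    · simp
    · rw [Complex.ofReal_mul, Complex.ofReal_cpow (by linarith)]
      push_cast
      rfl
  have h2 : HasSum (fun n => if n ∈ Finset.range N then |r n| else 0)
      (∑ n ∈ Finset.range N, |r n|) := by
    have := hasSum_sum_of_ne_finset_zero (L := .unconditional ℕ)
      (f := fun n => if n ∈ Finset.range N then |r n| else 0)
      (s := Finset.range N) (fun n hn => if_neg hn)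
    rwa [Finset.sum_congr rfl (fun n hn => if_pos hn)] at this
  have h3 := h2.add (h1.mul_left ε)
  refine hS.norm_le_of_bounded h3 fun n => ?_
  have hz1 : ‖z‖ ^ n ≤ 1 := pow_le_one₀ (norm_nonneg _) hz.le
  have hz0 : 0 ≤ ‖z‖ ^ n := by positivity
  have hg : 0 ≤ Real.Gamma (n + a) / n.factorial :=
    div_nonneg (Real.Gamma_pos_of_pos (by positivity)).le (by positivity)
  rw [norm_mul, norm_pow, Complex.norm_real, Real.norm_eq_abs]
  by_cases hn : n < N
  · rw [if_pos (Finset.mem_range.2 hn)]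
    have := mul_le_mul_of_nonneg_left hz1 (abs_nonneg (r n))
    have : 0 ≤ ε * (Real.Gamma (n + a) / n.factorial * ‖z‖ ^ n) := by positivity
    linarith
  · rw [if_neg (by simpa using hn), zero_add, ← mul_assoc]
    exact mul_le_mul_of_nonneg_right (hr n (not_lt.1 hn)) hz0

/-- With coefficients exactly `Γ(n+a)/n!` the sum is `M t = Γ(a)(1 - z)^(-a)` and the limit is
immediate. The relative error of the coefficients is small from some index on, and contributes
little because `z` approaches 1 nontangentially, at scale `1/T`. -/
lemma tendsto_rpow_neg_mul_of_tendsto_ratio {l : Filter ℝ} {a : ℝ} (ha : 0 < a) {d : ℕ → ℝ}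
    (hd : Tendsto (fun n : ℕ => d n / (Real.Gamma (n + a) / n.factorial)) atTop (𝓝 1))
    {z S : ℝ → ℂ} {T : ℝ → ℝ} {σ : ℂ} (hσ : 0 < σ.re) (hT : Tendsto T l atTop)
    (hz : ∀ t, ‖z t‖ < 1) (hzσ : Tendsto (fun t => (T t : ℂ) * (1 - z t)) l (𝓝 σ))
    (hS : ∀ t, HasSum (fun n => (d n : ℂ) * z t ^ n) (S t)) :
    Tendsto (fun t => ((T t ^ (-a) : ℝ) : ℂ) * S t) l (𝓝 (Real.Gamma a * σ ^ (-(a : ℂ)))) := by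
  have hGa := Real.Gamma_pos_of_pos ha
  have hTpos : ∀ᶠ t in l, 0 < T t := hT.eventually_gt_atTop 0
  set M : ℝ → ℂ := fun t => Real.Gamma a * (1 - z t) ^ (-(a : ℂ))
  have hmain : Tendsto (fun t => ((T t ^ (-a) : ℝ) : ℂ) * M t) l
      (𝓝 (Real.Gamma a * σ ^ (-(a : ℂ)))) := by
    refine ((hzσ.cpow tendsto_const_nhds (Or.inl hσ)).const_mul (Real.Gamma a : ℂ)).congr' ?_
    filter_upwards [hTpos] with t ht
    simp only [M]
    have hne : 1 - z t ≠ 0 := by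
      rw [sub_ne_zero]
      rintro h
      have := hz t
      rw [← h] at this
      simp at this
    rw [Complex.ofReal_cpow ht.le, ofReal_mul_cpow ht hne]
    push_cast
    ring
  -- The nontangential bound: `T(1 - |z|²) = 2 Re(T(1-z)) - |T(1-z)|²/T` tends to `2 Re σ`, and `1 -
  -- |z|² ≤ 2(1 - |z|)`.
  have hbd : ∀ᶠ t in l, σ.re / 2 ≤ T t * (1 - ‖z t‖) := by
    have h1 : Tendsto (fun t => 2 * ((T t : ℂ) * (1 - z t)).re
        - ‖(T t : ℂ) * (1 - z t)‖ ^ 2 / T t) l (𝓝 (2 * σ.re - 0)) := by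
      refine ((Complex.continuous_re.tendsto _ |>.comp hzσ).const_mul 2).sub ?_
      exact (hzσ.norm.pow 2).div_atTop hT
    have h2 : ∀ᶠ t in l, σ.re < 2 * ((T t : ℂ) * (1 - z t)).re
        - ‖(T t : ℂ) * (1 - z t)‖ ^ 2 / T t := h1.eventually_const_lt (by linarith)
    filter_upwards [h2, hTpos] with t ht ht0
    have h3 : 2 * ((T t : ℂ) * (1 - z t)).re - ‖(T t : ℂ) * (1 - z t)‖ ^ 2 / T t
        = T t * (1 - ‖z t‖ ^ 2) := by
      rw [norm_mul, mul_pow, Complex.norm_real, Real.norm_eq_abs, sq_abs, Complex.sq_norm,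
        Complex.sq_norm, Complex.normSq_apply, Complex.normSq_apply]
      simp
      field_simp
      ring
    rw [h3] at ht
    have h4 : 1 - ‖z t‖ ^ 2 ≤ 2 * (1 - ‖z t‖) := by nlinarith [sq_nonneg (1 - ‖z t‖)]
    have := mul_le_mul_of_nonneg_left h4 ht0.le
    linarith
  have herr : Tendsto (fun t => ((T t ^ (-a) : ℝ) : ℂ) * (S t - M t)) l (𝓝 0) := by
    rw [tendsto_zero_iff_norm_tendsto_zero, Metric.tendsto_nhds]
    intro δ hδ
    set K : ℝ := Real.Gamma a * (σ.re / 2) ^ (-a) with hK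
    have hKpos : 0 < K := mul_pos hGa (Real.rpow_pos_of_pos (by linarith) _)
    obtain ⟨ε, hε, hεK⟩ : ∃ ε : ℝ, 0 < ε ∧ ε * K < δ / 2 :=
      ⟨δ / 4 / K, by positivity, by rw [div_mul_cancel₀ _ hKpos.ne']; linarith⟩
    obtain ⟨N, hN⟩ := (Metric.tendsto_atTop.1 hd) ε hε
    have hr : ∀ n, N ≤ n → |d n - Real.Gamma (n + a) / n.factorial|
        ≤ ε * (Real.Gamma (n + a) / n.factorial) := by
      intro n hn
      have hg : 0 < Real.Gamma (n + a) / n.factorial :=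
        div_pos (Real.Gamma_pos_of_pos (by positivity)) (by positivity)
      have := (hN n hn).le
      rw [Real.dist_eq, div_sub_one hg.ne', abs_div, abs_of_pos hg, div_le_iff₀ hg] at this
      exact this
    have hT0 : Tendsto (fun t => T t ^ (-a) *
        ∑ n ∈ Finset.range N, |d n - Real.Gamma (n + a) / n.factorial|) l (𝓝 0) := by
      simpa using ((tendsto_rpow_neg_atTop ha).comp hT).mul_const
        (∑ n ∈ Finset.range N, |d n - Real.Gamma (n + a) / n.factorial|)
    filter_upwards [hbd, hTpos, hT0.eventually_lt_const (half_pos hδ)] with t h1 h2 h3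
    have hSM : HasSum (fun n => ((d n - Real.Gamma (n + a) / n.factorial : ℝ) : ℂ) * z t ^ n)
        (S t - M t) := by
      refine ((hS t).sub (hasSum_Gamma_mul_pow ha (hz t))).congr_fun fun n => ?_
      push_cast
      ring
    have h4 := norm_tsum_le_of_abs_le ha hε.le hr (hz t) hSM
    have hTa : 0 < T t ^ (-a) := Real.rpow_pos_of_pos h2 _
    have h5 : T t ^ (-a) * (Real.Gamma a * (1 - ‖z t‖) ^ (-a)) ≤ K := by
      rw [mul_left_comm, hK, ← Real.mul_rpow h2.le (by linarith [hz t])]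
      refine mul_le_mul_of_nonneg_left ?_ hGa.le
      exact Real.rpow_le_rpow_of_nonpos (by linarith) h1 (by linarith)
    rw [Real.dist_eq, sub_zero, abs_of_nonneg (norm_nonneg _), norm_mul, Complex.norm_real,
      Real.norm_eq_abs, abs_of_pos hTa]
    calc _ ≤ T t ^ (-a) * (∑ n ∈ Finset.range N, |d n - Real.Gamma (n + a) / n.factorial|
          + ε * (Real.Gamma a * (1 - ‖z t‖) ^ (-a))) := mul_le_mul_of_nonneg_left h4 hTa.le
      _ = T t ^ (-a) * ∑ n ∈ Finset.range N, |d n - Real.Gamma (n + a) / n.factorial|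
          + ε * (T t ^ (-a) * (Real.Gamma a * (1 - ‖z t‖) ^ (-a))) := by ring
      _ < δ / 2 + δ / 2 := add_lt_add_of_lt_of_le h3
          ((mul_le_mul_of_nonneg_left h5 hε.le).trans hεK.le)
      _ = δ := add_halves δ
  have := hmain.add herr
  rw [add_zero] at this
  refine this.congr fun t => ?_
  ring

/-- Dividing the base by `|t|` sends it to `iε`, with `ε` the sign of `t`; principal powers are
continuous there and multiplicative in a positive real factor. -/
lemma tendsto_abs_rpow_mul_cpow {l : Filter ℝ} {ε : ℝ} (hε : ε ≠ 0) (hl : ∀ᶠ t in l, t = ε * |t|)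
    (habs : Tendsto (fun t : ℝ => |t|) l atTop) (c τ : ℝ) :
    Tendsto (fun t : ℝ => ((|t| ^ (-c) : ℝ) : ℂ) * (1 + Complex.I * ((τ + t : ℝ) : ℂ)) ^ (c : ℂ)) l
      (𝓝 ((Complex.I * ε) ^ (c : ℂ))) := by
  have hinv : Tendsto (fun t : ℝ => ((|t|⁻¹ : ℝ) : ℂ)) l (𝓝 0) := by
    have := (Complex.continuous_ofReal.tendsto 0).comp (tendsto_inv_atTop_zero.comp habs)
    rw [Complex.ofReal_zero] at this
    exact this
  have h1 : Tendsto (fun t : ℝ => ((|t|⁻¹ : ℝ) : ℂ) * (1 + Complex.I * τ) + Complex.I * ε) l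
      (𝓝 (Complex.I * ε)) := by
    simpa using (hinv.mul_const (1 + Complex.I * τ)).add_const (Complex.I * (ε : ℂ))
  have h2 := h1.cpow (tendsto_const_nhds (x := (c : ℂ))) (Or.inr (by simpa using hε))
  refine h2.congr' ?_
  filter_upwards [hl, habs.eventually_gt_atTop 0] with t ht ht0
  have h3 : ((|t|⁻¹ : ℝ) : ℂ) * (1 + Complex.I * τ) + Complex.I * ε
      = ((|t|⁻¹ : ℝ) : ℂ) * (1 + Complex.I * ((τ + t : ℝ) : ℂ)) := by
    have : (ε : ℂ) = ((|t|⁻¹ : ℝ) : ℂ) * t := by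
      rw [← Complex.ofReal_mul]
      congr 1
      field_simp
      linarith
    rw [this]
    push_cast
    ring
  rw [h3, ofReal_mul_cpow (inv_pos.2 ht0) (one_add_I_mul_ne_zero _), ← Complex.ofReal_cpow
    (inv_pos.2 ht0).le, Real.inv_rpow ht0.le, Real.rpow_neg ht0.le]

/-- The source of the phase in the wave operators: `log(±i) = ±iπ/2`. -/
lemma I_mul_sign_cpow {ε : ℝ} (hε : ε = 1 ∨ ε = -1) (c : ℝ) :
    (Complex.I * ε) ^ (c : ℂ) = Complex.exp (Complex.I * ((c * ε * Real.pi / 2 : ℝ) : ℂ)) := by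
  rcases hε with rfl | rfl
  · rw [Complex.ofReal_one, mul_one, Complex.cpow_def_of_ne_zero Complex.I_ne_zero, Complex.log_I]
    push_cast
    ring_nf
  · rw [Complex.ofReal_neg, Complex.ofReal_one, mul_neg_one,
      Complex.cpow_def_of_ne_zero (neg_ne_zero.2 Complex.I_ne_zero), Complex.log_neg_I]
    push_cast
    ring_nf

/-! ### Asymptotic overlaps of coherent states -/

/-- The parameter `-it / (1 + it)` of the coherent state `e ^ (-itJ) e₀`. -/
noncomputable def coherentParam (t : ℝ) : ℂ := -(Complex.I * t) / (1 + Complex.I * t)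

lemma laguerreAmplitude_eq (p : ℝ) (n : ℕ) (t : ℝ) : laguerreAmplitude p n t
    = laguerreCoeff p n * ((1 + Complex.I * t) ^ ((-(p + 1) : ℝ) : ℂ) * coherentParam t ^ n) := by
  rw [laguerreAmplitude, coherentParam]
  push_cast
  rfl

lemma norm_coherentParam_lt_one (t : ℝ) : ‖coherentParam t‖ < 1 := by
  have h : 0 < ‖1 + Complex.I * t‖ := norm_pos_iff.2 (one_add_I_mul_ne_zero t)
  rw [coherentParam, norm_div, div_lt_one h]
  refine lt_of_pow_lt_pow_left₀ 2 h.le ?_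
  rw [Complex.sq_norm, Complex.sq_norm, Complex.normSq_apply, Complex.normSq_apply]
  simp

/-- For `s = τ + t` and `s' = τ' + t` the first factor does not depend on `t` and the others decay
like `1/|t|` each; this is the scale at which the power series approaches its singularity. -/
lemma one_sub_coherentParam_mul (s s' : ℝ) :
    1 - (starRingEnd ℂ) (coherentParam s') * coherentParam s
      = (1 + Complex.I * ((s - s' : ℝ) : ℂ)) *
        ((1 + Complex.I * s)⁻¹ * (1 + Complex.I * ((-s' : ℝ) : ℂ))⁻¹) := by
  have h1 := one_add_I_mul_ne_zero s
  have h2 := one_add_I_mul_ne_zero (-s')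
  have h3 : (starRingEnd ℂ) (coherentParam s')
      = -(Complex.I * ((-s' : ℝ) : ℂ)) / (1 + Complex.I * ((-s' : ℝ) : ℂ)) := by
    simp [coherentParam]
  rw [h3, coherentParam]
  field_simp
  push_cast
  ring

lemma laguerreCoeff_mul_laguerreCoeff {p q : ℝ} (hp : -1 < p) (hq : -1 < q) (n : ℕ) :
    laguerreCoeff q n * laguerreCoeff p n = (√(Real.Gamma (p + 1) * Real.Gamma (q + 1)))⁻¹ *
      (√(Real.Gamma (n + (p + 1)) * Real.Gamma (n + (q + 1))) / n.factorial) := by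
  have hn : (0 : ℝ) ≤ n := n.cast_nonneg
  have h1 := Real.Gamma_pos_of_pos (s := p + 1) (by linarith)
  have h2 := Real.Gamma_pos_of_pos (s := q + 1) (by linarith)
  have h3 := Real.Gamma_pos_of_pos (s := n + (p + 1)) (by linarith)
  have h4 := Real.Gamma_pos_of_pos (s := n + (q + 1)) (by linarith)
  have h5 : (0 : ℝ) < n.factorial := by exact_mod_cast n.factorial_pos
  rw [laguerreCoeff, laguerreCoeff, ← Real.sqrt_mul (by positivity), ← Real.sqrt_inv,
    ← Real.sqrt_sq h5.le, ← Real.sqrt_div (by positivity), ← Real.sqrt_mul (by positivity),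
    Real.sqrt_sq h5.le]
  congr 1
  field_simp

/-- After the prefactors `κ`, `u` and the conjugate of `v` are removed, `S` is a power series to
which the Abelian theorem applies with `T = |t|²` and `σ = 1 + i(τ-τ')`. The prefactors then
contribute the phase. -/
lemma tendsto_of_hasSum_laguerreAmplitude {p q : ℝ} (hp : -1 < p) (hq : -1 < q) {l : Filter ℝ}
    {ε : ℝ} (hε : ε = 1 ∨ ε = -1) (hl : ∀ᶠ t in l, t = ε * |t|)
    (habs : Tendsto (fun t : ℝ => |t|) l atTop) (τ τ' : ℝ) {S : ℝ → ℂ}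
    (hS : ∀ t : ℝ, HasSum (fun n => (starRingEnd ℂ) (laguerreAmplitude q n (τ' + t))
      * laguerreAmplitude p n (τ + t)) (S t)) :
    Tendsto S l (𝓝 (Complex.exp (Complex.I * ((ε * ((q - p) * Real.pi / 2) : ℝ) : ℂ)) *
      ((Real.Gamma ((p + q) / 2 + 1) / √(Real.Gamma (p + 1) * Real.Gamma (q + 1)) : ℝ)
        * (1 + Complex.I * ((τ - τ' : ℝ) : ℂ)) ^ (-((((p + q) / 2 : ℝ) : ℂ) + 1))))) := by
  have hε0 : ε ≠ 0 := by rcases hε with rfl | rfl <;> norm_num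
  have hGp : 0 < Real.Gamma (p + 1) := Real.Gamma_pos_of_pos (by linarith)
  have hGq : 0 < Real.Gamma (q + 1) := Real.Gamma_pos_of_pos (by linarith)
  set κ : ℝ := (√(Real.Gamma (p + 1) * Real.Gamma (q + 1)))⁻¹ with hκ
  have hκ0 : (κ : ℂ) ≠ 0 := by
    have : κ ≠ 0 := by positivity
    exact_mod_cast this
  set D : ℕ → ℝ := fun n => √(Real.Gamma (n + (p + 1)) * Real.Gamma (n + (q + 1))) / n.factorial
  set a : ℝ := (p + q) / 2 + 1 with ha
  have ha0 : 0 < a := by linarith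
  set z : ℝ → ℂ := fun t => (starRingEnd ℂ) (coherentParam (τ' + t)) * coherentParam (τ + t) with hz
  set u : ℝ → ℂ := fun t => (1 + Complex.I * ((τ + t : ℝ) : ℂ)) ^ ((-(p + 1) : ℝ) : ℂ) with hu
  set v : ℝ → ℂ := fun t => (1 + Complex.I * ((τ' + t : ℝ) : ℂ)) ^ ((-(q + 1) : ℝ) : ℂ) with hv
  have hu0 : ∀ t, u t ≠ 0 := fun t h =>
    one_add_I_mul_ne_zero _ ((Complex.cpow_eq_zero_iff _ _).1 h).1
  have hv0 : ∀ t, (starRingEnd ℂ) (v t) ≠ 0 := fun t h =>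
    one_add_I_mul_ne_zero _ ((Complex.cpow_eq_zero_iff _ _).1 ((map_eq_zero _).1 h)).1
  have hsum : ∀ t, HasSum (fun n => (D n : ℂ) * z t ^ n)
      ((κ * (starRingEnd ℂ) (v t) * u t)⁻¹ * S t) := by
    intro t
    refine ((hS t).mul_left (κ * (starRingEnd ℂ) (v t) * u t)⁻¹).congr_fun fun n => ?_
    have h1 : (laguerreCoeff q n : ℂ) * laguerreCoeff p n = κ * D n := by
      exact_mod_cast laguerreCoeff_mul_laguerreCoeff hp hq n
    rw [laguerreAmplitude_eq, laguerreAmplitude_eq, map_mul, map_mul, map_pow, Complex.conj_ofReal,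
      hz, mul_pow]
    have h2 := hu0 t
    have h3 := hv0 t
    change _ = _ * ((laguerreCoeff q n : ℂ) * ((starRingEnd ℂ) (v t) * _) *
      (laguerreCoeff p n * (u t * _)))
    field_simp
    linear_combination (-(starRingEnd ℂ) (coherentParam (τ' + t)) ^ n
      * coherentParam (τ + t) ^ n) * h1
  have hratio : Tendsto (fun n : ℕ => D n / (Real.Gamma (n + a) / n.factorial)) atTop (𝓝 1) := by
    refine (tendsto_sqrt_Gamma_mul_Gamma_div (x := p + 1) (y := q + 1) (by linarith)
      (by linarith)).congr fun n => ?_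
    have h5 : (n.factorial : ℝ) ≠ 0 := by exact_mod_cast n.factorial_ne_zero
    rw [show (p + 1 + (q + 1)) / 2 = a by rw [ha]; ring, div_div_div_cancel_right₀ h5]
  have hT : Tendsto (fun t : ℝ => |t| ^ 2) l atTop := (tendsto_pow_atTop two_ne_zero).comp habs
  have habs0 := habs.eventually_gt_atTop 0
  have h1 := tendsto_abs_rpow_mul_cpow hε0 hl habs (-1) τ
  have h2 := (Complex.continuous_conj.tendsto _).comp
    (tendsto_abs_rpow_mul_cpow hε0 hl habs (-1) τ')
  have hzσ : Tendsto (fun t : ℝ => ((|t| ^ 2 : ℝ) : ℂ) * (1 - z t)) l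
      (𝓝 (1 + Complex.I * ((τ - τ' : ℝ) : ℂ))) := by
    have h3 := (h1.mul h2).const_mul (1 + Complex.I * ((τ - τ' : ℝ) : ℂ))
    have h4 : (Complex.I * (ε : ℂ)) ^ ((-1 : ℝ) : ℂ) *
        (starRingEnd ℂ) ((Complex.I * (ε : ℂ)) ^ ((-1 : ℝ) : ℂ)) = 1 := by
      rw [Complex.ofReal_neg, Complex.ofReal_one, Complex.cpow_neg_one]
      rcases hε with rfl | rfl <;> simp
    rw [h4, mul_one] at h3
    refine h3.congr fun t => ?_
    rw [hz]
    simp only [Function.comp]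
    rw [one_sub_coherentParam_mul, neg_neg, Real.rpow_one, Complex.ofReal_neg, Complex.ofReal_one,
      Complex.cpow_neg_one, Complex.cpow_neg_one, map_mul, Complex.conj_ofReal, map_inv₀, map_add,
      map_mul, Complex.conj_I, Complex.conj_ofReal, map_one]
    push_cast
    ring_nf
  have hzlt : ∀ t, ‖z t‖ < 1 := fun t => by
    rw [hz, norm_mul, RCLike.norm_conj]
    exact mul_lt_one_of_nonneg_of_lt_one_left (norm_nonneg _) (norm_coherentParam_lt_one _)
      (norm_coherentParam_lt_one _).le
  have hmain := tendsto_rpow_neg_mul_of_tendsto_ratio ha0 hratio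
    (σ := 1 + Complex.I * ((τ - τ' : ℝ) : ℂ))
    (by simp) hT hzlt hzσ hsum
  have h3 := tendsto_abs_rpow_mul_cpow hε0 hl habs (-(p + 1)) τ
  have h4 := (Complex.continuous_conj.tendsto _).comp
    (tendsto_abs_rpow_mul_cpow hε0 hl habs (-(q + 1)) τ')
  have h5 := ((h3.mul h4).mul hmain).const_mul (κ : ℂ)
  have h10 : (κ : ℂ) * ((Complex.I * (ε : ℂ)) ^ ((-(p + 1) : ℝ) : ℂ) *
      (starRingEnd ℂ) ((Complex.I * (ε : ℂ)) ^ ((-(q + 1) : ℝ) : ℂ)) *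
        (Real.Gamma a * (1 + Complex.I * ((τ - τ' : ℝ) : ℂ)) ^ (-(a : ℂ))))
      = Complex.exp (Complex.I * ((ε * ((q - p) * Real.pi / 2) : ℝ) : ℂ)) *
        ((Real.Gamma a / √(Real.Gamma (p + 1) * Real.Gamma (q + 1)) : ℝ)
          * (1 + Complex.I * ((τ - τ' : ℝ) : ℂ)) ^ (-((((p + q) / 2 : ℝ) : ℂ) + 1))) := by
    rw [I_mul_sign_cpow hε, I_mul_sign_cpow hε, ← Complex.exp_conj]
    have h6 : Complex.exp (Complex.I * ((ε * ((q - p) * Real.pi / 2) : ℝ) : ℂ))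
        = Complex.exp (Complex.I * ((-(p + 1) * ε * Real.pi / 2 : ℝ) : ℂ)) *
          Complex.exp ((starRingEnd ℂ) (Complex.I * ((-(q + 1) * ε * Real.pi / 2 : ℝ) : ℂ))) := by
      rw [← Complex.exp_add, map_mul, Complex.conj_I, Complex.conj_ofReal]
      congr 1
      push_cast
      ring
    have h7 : Real.Gamma a / √(Real.Gamma (p + 1) * Real.Gamma (q + 1)) = Real.Gamma a * κ := by
      rw [hκ, div_eq_mul_inv]
    have h8 : (((p + q) / 2 : ℝ) : ℂ) + 1 = (a : ℂ) := by rw [ha]; push_cast; rfl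
    rw [h6, h7, h8, Complex.ofReal_mul]
    ring
  rw [← h10]
  refine h5.congr' ?_
  filter_upwards [habs0] with t ht
  -- No power of `|t|` survives, because `2a = (p+1) + (q+1)`.
  have h6 : |t| ^ (p + 1) * |t| ^ (q + 1) * (|t| ^ 2) ^ (-a) = 1 := by
    rw [← Real.rpow_natCast, ← Real.rpow_mul ht.le, ← Real.rpow_add ht, ← Real.rpow_add ht]
    rw [show p + 1 + (q + 1) + ((2 : ℕ) : ℝ) * -a = 0 by rw [ha]; push_cast; ring, Real.rpow_zero]
  have h7 : ((|t| ^ (p + 1) : ℝ) : ℂ) * ((|t| ^ (q + 1) : ℝ) : ℂ) *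
      (((|t| ^ 2) ^ (-a) : ℝ) : ℂ) = 1 := by
    exact_mod_cast h6
  simp only [Function.comp, neg_neg, map_mul, Complex.conj_ofReal]
  change (κ : ℂ) * ((_ * u t) * (_ * (starRingEnd ℂ) (v t)) * _) = _
  have h8 := hu0 t
  have h9 := hv0 t
  field_simp
  linear_combination S t * h7

/-! ### Completeness of the Laguerre functions and the transform -/

/-- Binomial series at `|w|²`, with `1 - |w|² = 1/(1+t²)`. It is Parseval's equality for the evolved
ground state, obtained before completeness is known. -/
lemma hasSum_norm_sq_laguerreAmplitude {p : ℝ} (hp : -1 < p) (t : ℝ) :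
    HasSum (fun n => ‖laguerreAmplitude p n t‖ ^ 2) 1 := by
  set r := ‖1 + Complex.I * t‖ with hr
  have hr0 : 0 < r := norm_pos_iff.2 (one_add_I_mul_ne_zero t)
  have hr2 : r ^ 2 = 1 + t ^ 2 := by
    rw [hr, Complex.sq_norm, Complex.normSq_apply]
    simp [sq]
  have hw : 1 - ‖coherentParam t‖ ^ 2 = (r ^ 2)⁻¹ := by
    rw [coherentParam, norm_div, ← hr, div_pow, norm_neg, norm_mul, Complex.norm_I, one_mul,
      Complex.norm_real, Real.norm_eq_abs, sq_abs]
    field_simp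
    linarith
  have hG : 0 < Real.Gamma (p + 1) := Real.Gamma_pos_of_pos (by linarith)
  have hwlt : ‖coherentParam t‖ ^ 2 < 1 := by
    have : 0 < (r ^ 2)⁻¹ := by positivity
    linarith
  have h1 := hasSum_Gamma_mul_pow (a := p + 1) (by linarith)
    (z := ((‖coherentParam t‖ ^ 2 : ℝ) : ℂ)) (by
      rw [Complex.norm_real, Real.norm_of_nonneg (sq_nonneg _)]
      exact hwlt)
  have h2 : HasSum (fun n : ℕ => Real.Gamma (n + (p + 1)) / n.factorial *
      (‖coherentParam t‖ ^ 2) ^ n) (Real.Gamma (p + 1) * (r ^ 2) ^ (p + 1)) := by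
    rw [← Complex.hasSum_ofReal]
    convert! h1 using 1
    · simp
    · rw [← Complex.ofReal_one, ← Complex.ofReal_sub, hw, ← Complex.ofReal_neg,
        ← Complex.ofReal_cpow (by positivity), Real.inv_rpow (by positivity),
        Real.rpow_neg (by positivity), inv_inv]
      push_cast
      rfl
  have h3 := h2.mul_left ((r ^ (-(p + 1))) ^ 2 / Real.Gamma (p + 1))
  convert! h3 using 1
  · funext n
    rw [laguerreAmplitude_eq, norm_mul, norm_mul, norm_pow, Complex.norm_cpow_real, ← hr,
      Complex.norm_real, Real.norm_eq_abs, mul_pow, sq_abs, laguerreCoeff, Real.sq_sqrt]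
    · rw [mul_pow, ← pow_mul, mul_comm n 2, pow_mul]
      field_simp
    · have : 0 < Real.Gamma (n + (p + 1)) :=
        Real.Gamma_pos_of_pos (by have : (0 : ℝ) ≤ n := n.cast_nonneg
                                  linarith)
      positivity
  · have h4 : (r ^ (-(p + 1))) ^ 2 * (r ^ 2) ^ (p + 1) = 1 := by
      rw [← Real.rpow_natCast, ← Real.rpow_natCast, ← Real.rpow_mul hr0.le, ← Real.rpow_mul hr0.le,
        ← Real.rpow_add hr0]
      rw [show -(p + 1) * ((2 : ℕ) : ℝ) + ((2 : ℕ) : ℝ) * (p + 1) = 0 by ring, Real.rpow_zero]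
    field_simp
    linarith

/-- Equality in Bessel's inequality puts `x` in the closed span. Concretely, `⟨x,y⟩ = ⟨x - s,y⟩` for
each partial sum `s`, and `‖x - s‖²` is the remainder of the series. -/
lemma inner_eq_zero_of_hasSum_norm_sq {H : Type*} [NormedAddCommGroup H] [InnerProductSpace ℂ H]
    {v : ℕ → H} (hv : Orthonormal ℂ v) {x y : H}
    (hx : HasSum (fun n => ‖inner ℂ (v n) x‖ ^ 2) (‖x‖ ^ 2)) (hy : ∀ n, inner ℂ (v n) y = 0) :
    inner ℂ x y = 0 := by
  have h1 : ∀ N, ‖inner ℂ x y‖ ^ 2 ≤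
      (‖x‖ ^ 2 - ∑ n ∈ Finset.range N, ‖inner ℂ (v n) x‖ ^ 2) * ‖y‖ ^ 2 := by
    intro N
    set s := ∑ n ∈ Finset.range N, inner ℂ (v n) x • v n with hs
    have hsy : inner ℂ s y = 0 := by
      simp [hs, hy]
    have hxs : inner ℂ x s = ((∑ n ∈ Finset.range N, ‖inner ℂ (v n) x‖ ^ 2 : ℝ) : ℂ) := by
      rw [hs, inner_sum]
      push_cast
      refine Finset.sum_congr rfl fun n _ => ?_
      rw [inner_smul_right, ← inner_conj_symm x (v n), Complex.mul_conj, Complex.normSq_eq_norm_sq]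
      push_cast
      rfl
    have hss : inner ℂ s s = ((∑ n ∈ Finset.range N, ‖inner ℂ (v n) x‖ ^ 2 : ℝ) : ℂ) := by
      rw [hs, hv.inner_sum]
      push_cast
      refine Finset.sum_congr rfl fun n _ => ?_
      rw [mul_comm, Complex.mul_conj, Complex.normSq_eq_norm_sq]
      push_cast
      rfl
    have hnorm : ‖x - s‖ ^ 2 = ‖x‖ ^ 2 - ∑ n ∈ Finset.range N, ‖inner ℂ (v n) x‖ ^ 2 := by
      have h2 : ‖s‖ ^ 2 = ∑ n ∈ Finset.range N, ‖inner ℂ (v n) x‖ ^ 2 := by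
        refine Complex.ofReal_injective ?_
        rw [← hss, Complex.ofReal_pow]
        exact (inner_self_eq_norm_sq_to_K (𝕜 := ℂ) s).symm
      rw [@norm_sub_sq ℂ, hxs, h2, RCLike.re_to_complex, Complex.ofReal_re]
      ring
    have h3 := norm_inner_le_norm (𝕜 := ℂ) (x - s) y
    rw [inner_sub_left, hsy, sub_zero] at h3
    rw [← hnorm, ← mul_pow]
    exact pow_le_pow_left₀ (norm_nonneg _) h3 2
  have h2 := ((hx.tendsto_sum_nat.const_sub (‖x‖ ^ 2)).mul_const (‖y‖ ^ 2))
  rw [sub_self, zero_mul] at h2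
  have h3 := ge_of_tendsto' h2 h1
  have h4 : ‖inner ℂ x y‖ = 0 := by nlinarith [norm_nonneg (inner ℂ x y)]
  exact norm_eq_zero.1 h4

lemma norm_laguerreLp {p : ℝ} (hp : -1 < p) (n : ℕ) : ‖laguerreLp hp n‖ = 1 :=
  (orthonormal_laguerreLp hp).1 n

/-- The normalized Laguerre functions as a Hilbert basis of `L²(ℝ₊)`. -/
noncomputable def laguerreBasis {p : ℝ} (hp : -1 < p) : HilbertBasis ℕ ℂ LTwoPos :=
  HilbertBasis.mkOfOrthogonalEqBot (orthonormal_laguerreLp hp) <| by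
    rw [Submodule.eq_bot_iff]
    intro F hF
    have hF' : ∀ n, inner ℂ (laguerreLp hp n) F = 0 := fun n =>
      (Submodule.mem_orthogonal _ _).1 hF _ (Submodule.subset_span ⟨n, rfl⟩)
    -- A vector orthogonal to all `φₙ` is orthogonal to the whole orbit of `φ₀`, which is total.
    refine eq_zero_of_inner_mulExp_laguerreLp_eq_zero hp fun t => ?_
    refine inner_eq_zero_of_hasSum_norm_sq (orthonormal_laguerreLp hp) ?_ hF'
    simpa only [inner_laguerreLp_mulExp_zero, LinearIsometry.norm_map, norm_laguerreLp, one_pow]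
      using hasSum_norm_sq_laguerreAmplitude hp t

lemma coe_laguerreBasis {p : ℝ} (hp : -1 < p) : ⇑(laguerreBasis hp) = laguerreLp hp :=
  HilbertBasis.coe_mkOfOrthogonalEqBot _ _

lemma eq_sum_single_of_forall_ge (N : ℕ) (f : EllTwo) (hf : ∀ n, N ≤ n → (f : ℕ → ℂ) n = 0) :
    f = ∑ n ∈ Finset.range N, (f : ℕ → ℂ) n • (lp.single 2 n (1 : ℂ) : EllTwo) := by
  refine lp.ext (funext fun m => ?_)
  rw [lp.coeFn_sum, Finset.sum_apply]
  by_cases hm : m < N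
  · rw [Finset.sum_eq_single m]
    · simp [lp.coeFn_smul]
    · intro n _ hnm
      simp [lp.coeFn_smul, lp.coeFn_single, hnm.symm]
    · intro h
      exact absurd (Finset.mem_range.2 hm) h
  · rw [hf m (not_lt.1 hm), eq_comm]
    refine Finset.sum_eq_zero fun n hn => ?_
    have : m ≠ n := by
      rintro rfl
      exact hm (Finset.mem_range.1 hn)
    simp [lp.coeFn_smul, lp.coeFn_single, this]

lemma isLaguerreTransform_iff {p : ℝ} (hp : -1 < p) (Φ : EllTwo ≃ₗᵢ[ℂ] LTwoPos) :
    IsLaguerreTransform p Φ ↔ ∀ n, Φ (lp.single 2 n (1 : ℂ)) = laguerreLp hp n := by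
  constructor
  · intro h n
    refine Lp.ext ?_
    have h1 := h (n + 1) (lp.single 2 n (1 : ℂ)) fun m hm => by
      have : m ≠ n := by omega
      simp [this]
    filter_upwards [h1, coeFn_laguerreLp hp n] with x h2 h3
    rw [h2, h3, Finset.sum_eq_single n]
    · simp
    · intro m _ hmn
      simp [hmn]
    · simp
  · intro h N f hf
    have h1 : Φ f = ∑ n ∈ Finset.range N, (f : ℕ → ℂ) n • laguerreLp hp n := by
      conv_lhs => rw [eq_sum_single_of_forall_ge N f hf]
      simp [h]
    have h2 : ∀ (c : ℕ → ℂ) (N : ℕ), (∑ n ∈ Finset.range N, c n • laguerreLp hp n : LTwoPos)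
        =ᵐ[volume.restrict (Set.Ioi (0 : ℝ))]
        fun x => ∑ n ∈ Finset.range N, (laguerreFun p n x : ℂ) * c n := by
      intro c N
      induction N with
      | zero =>
        simp only [Finset.range_zero, Finset.sum_empty]
        exact Lp.coeFn_zero ℂ 2 (volume.restrict (Set.Ioi (0 : ℝ)))
      | succ N ih =>
        rw [Finset.sum_range_succ]
        filter_upwards [ih, Lp.coeFn_add (∑ n ∈ Finset.range N, c n • laguerreLp hp n)
          (c N • laguerreLp hp N), Lp.coeFn_smul (c N) (laguerreLp hp N), coeFn_laguerreLp hp N]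
          with x h3 h4 h5 h6
        rw [h4, Pi.add_apply, h3, h5, Pi.smul_apply, h6, Finset.sum_range_succ, smul_eq_mul,
          mul_comm (c N)]
    rw [h1]
    exact h2 _ N

lemma IsLaguerreTransform.inner_laguerreLp {p : ℝ} (hp : -1 < p) {Φ : EllTwo ≃ₗᵢ[ℂ] LTwoPos}
    (hΦ : IsLaguerreTransform p Φ) (f : EllTwo) (n : ℕ) :
    inner ℂ (laguerreLp hp n) (Φ f) = (f : ℕ → ℂ) n := by
  rw [← (isLaguerreTransform_iff hp Φ).1 hΦ n, Φ.inner_map_map, lp.inner_single_left]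
  simp

lemma IsLaguerreTransform.symm_apply {p : ℝ} (hp : -1 < p) {Φ : EllTwo ≃ₗᵢ[ℂ] LTwoPos}
    (hΦ : IsLaguerreTransform p Φ) (F : LTwoPos) (n : ℕ) :
    (Φ.symm F : ℕ → ℂ) n = inner ℂ (laguerreLp hp n) F := by
  rw [← hΦ.inner_laguerreLp hp, Φ.apply_symm_apply]

lemma existsUnique_isLaguerreTransform {p : ℝ} (hp : -1 < p) :
    ∃! Φ : EllTwo ≃ₗᵢ[ℂ] LTwoPos, IsLaguerreTransform p Φ := by
  refine ⟨(laguerreBasis hp).repr.symm, ?_, fun Ψ hΨ => ?_⟩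
  · exact (isLaguerreTransform_iff hp _).2 fun n => by
      rw [HilbertBasis.repr_symm_single, coe_laguerreBasis]
  · have h : Ψ.symm = (laguerreBasis hp).repr := by
      refine LinearIsometryEquiv.ext fun F => lp.ext (funext fun n => ?_)
      rw [hΨ.symm_apply hp, HilbertBasis.repr_apply_apply, coe_laguerreBasis]
    rw [← h, LinearIsometryEquiv.symm_symm]

/-! ### Diagonalization on the maximal domain -/

lemma mem_graph_jacobiOperator_iff (a b : ℕ → ℝ) (f g : EllTwo) :
    (f, g) ∈ (jacobiOperator a b).graph ↔ jacobiMatrix a b (f : ℕ → ℂ) = (g : ℕ → ℂ) := by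
  rw [LinearPMap.mem_graph_iff]
  constructor
  · rintro ⟨y, hy, h⟩
    simp only at hy h
    rw [← h, ← hy]
    rfl
  · intro h
    refine ⟨⟨f, ?_⟩, rfl, ?_⟩
    · change Memℓp (jacobiMatrix a b (f : ℕ → ℂ)) 2
      rw [h]
      exact lp.memℓp g
    · exact lp.ext h

/-- Green's identity: pair the equation with the conjugate of `d` and take imaginary parts. The real
diagonal drops out and the off-diagonal terms telescope to one boundary term. -/
lemma sum_norm_sq_eq_of_jacobiMatrix_eq_I_smul {a b : ℕ → ℝ} {d : ℕ → ℂ}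
    (hd : jacobiMatrix a b d = Complex.I • d) (N : ℕ) :
    ∑ n ∈ Finset.range (N + 1), ‖d n‖ ^ 2 = a N * (d (N + 1) * (starRingEnd ℂ) (d N)).im := by
  induction N with
  | zero =>
    have h := congrArg Complex.im (congrArg (· * (starRingEnd ℂ) (d 0)) (congrFun hd 0))
    simp only [jacobiMatrix, LinearMap.coe_mk, AddHom.coe_mk, Pi.smul_apply, smul_eq_mul] at h
    simp at h
    simp [Complex.sq_norm, Complex.normSq_apply]
    linarith
  | succ N ih =>
    have h := congrArg Complex.im (congrArg (· * (starRingEnd ℂ) (d (N + 1))) (congrFun hd (N + 1)))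
    simp only [jacobiMatrix, LinearMap.coe_mk, AddHom.coe_mk, Pi.smul_apply, smul_eq_mul] at h
    rw [Finset.sum_range_succ, ih]
    simp at h
    simp [Complex.sq_norm, Complex.normSq_apply]
    linarith

/-- Carleman's argument. If `d M ≠ 0`, Green's identity bounds a multiple of `1/(N+1)` by the
summable `C(|d_N|² + |d_(N+1)|²)`, contradicting divergence of the harmonic series. -/
lemma eq_zero_of_jacobiMatrix_eq_I_smul {a b : ℕ → ℝ} {C : ℝ} (hC : 0 < C)
    (ha : ∀ n, |a n| ≤ C * ((n : ℝ) + 1)) {d : ℕ → ℂ} (hd2 : Summable fun n => ‖d n‖ ^ 2)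
    (hd : jacobiMatrix a b d = Complex.I • d) : d = 0 := by
  have key : ∀ M N, M ≤ N → ‖d M‖ ^ 2 * (1 / ((N : ℝ) + 1))
      ≤ C * (‖d N‖ ^ 2 + ‖d (N + 1)‖ ^ 2) := by
    intro M N hMN
    have h1 : ‖d M‖ ^ 2 ≤ ∑ n ∈ Finset.range (N + 1), ‖d n‖ ^ 2 :=
      Finset.single_le_sum (f := fun n => ‖d n‖ ^ 2) (fun _ _ => sq_nonneg _)
        (Finset.mem_range.2 (by omega))
    have hN : (0 : ℝ) < (N : ℝ) + 1 := by positivity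
    have h2 : a N * (d (N + 1) * (starRingEnd ℂ) (d N)).im
        ≤ C * ((N : ℝ) + 1) * (‖d (N + 1)‖ * ‖d N‖) := by
      refine (le_abs_self _).trans ?_
      rw [abs_mul]
      refine mul_le_mul (ha N) ?_ (abs_nonneg _) (by positivity)
      refine (Complex.abs_im_le_norm _).trans ?_
      rw [norm_mul, RCLike.norm_conj]
    rw [sum_norm_sq_eq_of_jacobiMatrix_eq_I_smul hd] at h1
    rw [mul_one_div, div_le_iff₀ hN]
    have h3 : ‖d (N + 1)‖ * ‖d N‖ ≤ ‖d N‖ ^ 2 + ‖d (N + 1)‖ ^ 2 := by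
      nlinarith [sq_nonneg (‖d (N + 1)‖ - ‖d N‖), sq_nonneg (‖d (N + 1)‖), sq_nonneg (‖d N‖)]
    have h4 := mul_le_mul_of_nonneg_left h3 (by positivity : 0 ≤ C * ((N : ℝ) + 1))
    linarith
  funext M
  by_contra hM
  have hM' : 0 < ‖d M‖ ^ 2 := by
    have : 0 < ‖d M‖ := norm_pos_iff.2 hM
    positivity
  have hsum : Summable fun N => C * (‖d N‖ ^ 2 + ‖d (N + 1)‖ ^ 2) :=
    (hd2.add ((summable_nat_add_iff 1).2 hd2)).mul_left C
  have h1 : Summable fun N : ℕ => ‖d M‖ ^ 2 * (1 / (((N + M : ℕ) : ℝ) + 1)) := by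
    refine Summable.of_nonneg_of_le (fun N => by positivity) (fun N => key M (N + M) (by omega))
      ((summable_nat_add_iff M).2 hsum)
  have h2 := (summable_mul_left_iff hM'.ne').1 h1
  have h3 : Summable fun N : ℕ => 1 / ((N : ℝ) + 1) :=
    (summable_nat_add_iff (f := fun N : ℕ => 1 / ((N : ℝ) + 1)) M).1 h2
  have h4 : Summable fun N : ℕ => 1 / (N : ℝ) := by
    rw [← summable_nat_add_iff 1]
    simpa using h3
  exact Real.not_summable_one_div_natCast h4

lemma abs_laguerreA_le {p : ℝ} (hp : -1 < p) (n : ℕ) :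
    |laguerreA p n| ≤ (1 + |p|) * ((n : ℝ) + 1) := by
  have h0 : (0 : ℝ) ≤ n := n.cast_nonneg
  rw [abs_of_pos (laguerreA_pos hp n)]
  refine le_of_pow_le_pow_left₀ two_ne_zero (by positivity) ?_
  rw [laguerreA_sq hp]
  have h1 : (n : ℝ) + 1 + p ≤ (1 + |p|) * (n + 1) := by
    nlinarith [le_abs_self p, mul_nonneg h0 (abs_nonneg p)]
  have h2 : (n : ℝ) + 1 ≤ (1 + |p|) * (n + 1) := by
    nlinarith [mul_nonneg h0 (abs_nonneg p), abs_nonneg p]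
  rw [sq]
  exact mul_le_mul h2 h1 (by linarith) (by positivity)

lemma laguerreFun_recurrence_zero {p : ℝ} (hp : -1 < p) (x : ℝ) :
    x * laguerreFun p 0 x = laguerreB p 0 * laguerreFun p 0 x
      + laguerreA p 0 * laguerreFun p 1 x := by
  have := orthoPoly_recurrence_zero (b := laguerreB p) (fun n => (laguerreA_pos hp n).ne') x
  simp only [laguerreFun]
  linear_combination √(laguerreDensity p x) * this

lemma laguerreFun_recurrence_succ {p : ℝ} (hp : -1 < p) (x : ℝ) (n : ℕ) :
    x * laguerreFun p (n + 1) x = laguerreA p n * laguerreFun p n x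
      + laguerreB p (n + 1) * laguerreFun p (n + 1) x
      + laguerreA p (n + 1) * laguerreFun p (n + 2) x := by
  have := orthoPoly_recurrence_succ (b := laguerreB p) (fun n => (laguerreA_pos hp n).ne') x n
  simp only [laguerreFun]
  linear_combination √(laguerreDensity p x) * this

lemma integrable_laguerreFun_mul {p : ℝ} (hp : -1 < p) (n : ℕ) (F : LTwoPos) :
    Integrable (fun x => (laguerreFun p n x : ℂ) * (F : ℝ → ℂ) x)
      (volume.restrict (Set.Ioi (0 : ℝ))) :=
  (memLp_laguerreFun hp n).integrable_mul (Lp.memLp F)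

lemma jacobiMatrix_inner_laguerreLp {p : ℝ} (hp : -1 < p) {F G : LTwoPos}
    (h : (G : ℝ → ℂ) =ᵐ[volume.restrict (Set.Ioi (0 : ℝ))] fun x => (x : ℂ) * (F : ℝ → ℂ) x) :
    jacobiMatrix (laguerreA p) (laguerreB p) (fun n => inner ℂ (laguerreLp hp n) F)
      = fun n => inner ℂ (laguerreLp hp n) G := by
  have hI := fun n => integrable_laguerreFun_mul hp n F
  funext n
  rcases n with _ | n
  · simp only [jacobiMatrix, LinearMap.coe_mk, AddHom.coe_mk, inner_laguerreLp_left]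
    rw [← integral_const_mul, ← integral_const_mul, ← integral_add ((hI 0).const_mul _)
      ((hI 1).const_mul _)]
    refine integral_congr_ae ?_
    filter_upwards [h] with x hx
    have h1 : (x : ℂ) * laguerreFun p 0 x = laguerreB p 0 * laguerreFun p 0 x
        + laguerreA p 0 * laguerreFun p 1 x := by exact_mod_cast laguerreFun_recurrence_zero hp x
    rw [hx]
    linear_combination -(F : ℝ → ℂ) x * h1
  · simp only [jacobiMatrix, LinearMap.coe_mk, AddHom.coe_mk, inner_laguerreLp_left]
    rw [← integral_const_mul, ← integral_const_mul, ← integral_const_mul,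
      ← integral_add ((hI n).const_mul _) ((hI (n + 1)).const_mul _),
      ← integral_add (((hI n).const_mul _).fun_add ((hI (n + 1)).const_mul _))
        ((hI (n + 2)).const_mul _)]
    refine integral_congr_ae ?_
    filter_upwards [h] with x hx
    have h1 : (x : ℂ) * laguerreFun p (n + 1) x = laguerreA p n * laguerreFun p n x
        + laguerreB p (n + 1) * laguerreFun p (n + 1) x
        + laguerreA p (n + 1) * laguerreFun p (n + 2) x := by
      exact_mod_cast laguerreFun_recurrence_succ hp x n
    rw [hx]
    linear_combination -(F : ℝ → ℂ) x * h1

/-- The resolvent of multiplication at `i`: `R = (x - i)⁻¹ F`, bounded because `|x - i| ≥ 1`. -/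
lemma exists_mul_eq_add_I_smul (F : LTwoPos) : ∃ R : LTwoPos,
    ((F + Complex.I • R : LTwoPos) : ℝ → ℂ) =ᵐ[volume.restrict (Set.Ioi (0 : ℝ))]
      fun x => (x : ℂ) * (R : ℝ → ℂ) x := by
  have hne : ∀ x : ℝ, (x : ℂ) - Complex.I ≠ 0 := fun x h => by
    simpa using congrArg Complex.im h
  have hmem : MemLp (fun x : ℝ => ((x : ℂ) - Complex.I)⁻¹ * (F : ℝ → ℂ) x) 2
      (volume.restrict (Set.Ioi (0 : ℝ))) := by
    refine (Lp.memLp F).of_le ?_ (Eventually.of_forall fun x => ?_)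
    · exact (Measurable.aestronglyMeasurable (by fun_prop)).mul (Lp.aestronglyMeasurable F)
    · rw [norm_mul]
      refine mul_le_of_le_one_left (norm_nonneg _) ?_
      rw [norm_inv]
      refine inv_le_one_of_one_le₀ ?_
      have := Complex.abs_im_le_norm ((x : ℂ) - Complex.I)
      simpa using this
  refine ⟨hmem.toLp _, ?_⟩
  filter_upwards [hmem.coeFn_toLp, Lp.coeFn_add F (Complex.I • hmem.toLp _),
    Lp.coeFn_smul Complex.I (hmem.toLp _)] with x h1 h2 h3
  rw [h2, Pi.add_apply, h3, Pi.smul_apply, h1, smul_eq_mul]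
  have := hne x
  field_simp
  ring

lemma IsLaguerreTransform.mem_graph_iff {p : ℝ} (hp : -1 < p) {Φ : EllTwo ≃ₗᵢ[ℂ] LTwoPos}
    (hΦ : IsLaguerreTransform p Φ) (f g : EllTwo) :
    (f, g) ∈ (laguerreOperator p).graph ↔
      (Φ g : ℝ → ℂ) =ᵐ[volume.restrict (Set.Ioi (0 : ℝ))] fun x => (x : ℂ) * (Φ f : ℝ → ℂ) x := by
  rw [laguerreOperator, mem_graph_jacobiOperator_iff]
  have hback : ∀ f g : EllTwo, ((Φ g : ℝ → ℂ) =ᵐ[volume.restrict (Set.Ioi (0 : ℝ))]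
      fun x => (x : ℂ) * (Φ f : ℝ → ℂ) x) →
      jacobiMatrix (laguerreA p) (laguerreB p) (f : ℕ → ℂ) = (g : ℕ → ℂ) := by
    intro f g h
    simpa only [hΦ.inner_laguerreLp hp] using jacobiMatrix_inner_laguerreLp hp h
  refine ⟨fun h => ?_, hback f g⟩
  -- Both `f` and `Φ.symm R` solve `(J - i)u = g - if` in `ℓ²`, so injectivity of `J - i` identifies
  -- them.
  obtain ⟨R, hR⟩ := exists_mul_eq_add_I_smul (Φ g - Complex.I • Φ f)
  have h1 := hback (Φ.symm R) (g - Complex.I • f + Complex.I • Φ.symm R) (by simpa using hR)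
  have h2 : jacobiMatrix (laguerreA p) (laguerreB p) ((f - Φ.symm R : EllTwo) : ℕ → ℂ)
      = Complex.I • ((f - Φ.symm R : EllTwo) : ℕ → ℂ) := by
    rw [lp.coeFn_sub, map_sub, h, h1, lp.coeFn_add, lp.coeFn_sub, lp.coeFn_smul, lp.coeFn_smul,
      smul_sub]
    abel
  have h3 := eq_zero_of_jacobiMatrix_eq_I_smul (C := 1 + |p|) (by positivity)
    (abs_laguerreA_le hp) (by
      have := (lp.memℓp (f - Φ.symm R : EllTwo)).summable (by norm_num)
      simpa using this) h2
  have h4 : f = Φ.symm R := sub_eq_zero.1 (lp.ext (by rw [h3, lp.coeFn_zero]))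
  have h5 : Φ f = R := by rw [h4, Φ.apply_symm_apply]
  rw [h5] at hR ⊢
  simpa using hR

/-! ### The unitary group and its generator -/

lemma coeFn_slope_mulExp (t : ℝ) (F : LTwoPos) :
    ((t⁻¹ • (mulExp (0 + t) F - mulExp 0 F) : LTwoPos) : ℝ → ℂ)
      =ᵐ[volume.restrict (Set.Ioi (0 : ℝ))]
      fun x => (t : ℂ)⁻¹ * ((Complex.exp (-(Complex.I * t * x)) - 1) * (F : ℝ → ℂ) x) := by
  rw [zero_add, mulExp_zero]
  filter_upwards [Lp.coeFn_smul t⁻¹ (mulExp t F - F), Lp.coeFn_sub (mulExp t F) F,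
    coeFn_mulExp t F] with x h1 h2 h3
  rw [h1, Pi.smul_apply, h2, Pi.sub_apply, h3, Complex.real_smul]
  push_cast
  ring

lemma tendsto_slope_exp_mul (x : ℝ) (w : ℂ) :
    Tendsto (fun t : ℝ => (t : ℂ)⁻¹ * ((Complex.exp (-(Complex.I * t * x)) - 1) * w)) (𝓝[≠] 0)
      (𝓝 (-(Complex.I * (x * w)))) := by
  have h1 : HasDerivAt (fun z : ℂ => -(Complex.I * z * x)) (-(Complex.I * x)) ((0 : ℝ) : ℂ) := by
    simpa using (((hasDerivAt_id (((0 : ℝ) : ℂ))).const_mul Complex.I).mul_const (x : ℂ)).fun_neg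
  have h2 := h1.cexp.comp_ofReal
  rw [hasDerivAt_iff_tendsto_slope_zero] at h2
  have h3 := h2.mul_const w
  convert! h3 using 2 with t
  · simp
    ring
  · simp
    ring

lemma continuous_mulExp (F : LTwoPos) : Continuous fun t => mulExp t F := by
  rw [continuous_iff_continuousAt]
  intro t₀
  refine tendsto_lp_two_of_dominated (fun x => 2 * ‖(F : ℝ → ℂ) x‖) (fun t => coeFn_mulExp t F)
    ((Lp.memLp F).norm.const_mul 2) (Eventually.of_forall fun t => ?_) ?_
  · filter_upwards [coeFn_mulExp t₀ F] with x hx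
    rw [hx]
    refine (norm_sub_le _ _).trans ?_
    rw [norm_mul, norm_mul, norm_exp_neg_I_mul, norm_exp_neg_I_mul]
    linarith
  · filter_upwards [coeFn_mulExp t₀ F] with x hx
    rw [hx]
    exact (by fun_prop : Continuous fun t : ℝ =>
      Complex.exp (-(Complex.I * t * x)) * (F : ℝ → ℂ) x).tendsto t₀

lemma coeFn_neg_I_smul (G : LTwoPos) :
    ((-(Complex.I • G) : LTwoPos) : ℝ → ℂ) =ᵐ[volume.restrict (Set.Ioi (0 : ℝ))]
      fun x => -(Complex.I * (G : ℝ → ℂ) x) := by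
  filter_upwards [Lp.coeFn_neg (Complex.I • G), Lp.coeFn_smul Complex.I G] with x h1 h2
  rw [h1, Pi.neg_apply, h2, Pi.smul_apply, smul_eq_mul]

lemma hasDerivAt_mulExp_zero_iff (F G : LTwoPos) :
    HasDerivAt (fun t => mulExp t F) (-(Complex.I • G)) 0 ↔
      (G : ℝ → ℂ) =ᵐ[volume.restrict (Set.Ioi (0 : ℝ))] fun x => (x : ℂ) * (F : ℝ → ℂ) x := by
  rw [hasDerivAt_iff_tendsto_slope_zero]
  constructor
  · intro h
    have hseq : Tendsto (fun k : ℕ => 1 / ((k : ℝ) + 1)) atTop (𝓝[≠] 0) := by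
      rw [tendsto_nhdsWithin_iff]
      refine ⟨tendsto_one_div_add_atTop_nhds_zero_nat, Eventually.of_forall fun k => ?_⟩
      have : 0 < 1 / ((k : ℝ) + 1) := by positivity
      exact this.ne'
    -- `L²` convergence of the difference quotients yields almost everywhere convergence only along
    -- a subsequence, which suffices to compare with their pointwise limit.
    obtain ⟨ns, hns, hlim⟩ := (tendstoInMeasure_of_tendsto_Lp (h.comp hseq)).exists_seq_tendsto_ae
    have hall := ae_all_iff.2 fun k : ℕ => coeFn_slope_mulExp (1 / ((k : ℝ) + 1)) F
    filter_upwards [hlim, hall, coeFn_neg_I_smul G] with x h1 h2 h3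
    have h4 := ((tendsto_slope_exp_mul x ((F : ℝ → ℂ) x)).comp hseq).comp hns.tendsto_atTop
    have h5 := tendsto_nhds_unique (h1.congr fun k => h2 (ns k)) h4
    rw [h3] at h5
    exact mul_left_cancel₀ Complex.I_ne_zero (neg_injective h5)
  · intro h
    refine tendsto_lp_two_of_dominated (fun x => 2 * ‖(G : ℝ → ℂ) x‖)
      (fun t => coeFn_slope_mulExp t F) ((Lp.memLp G).norm.const_mul 2) ?_ ?_
    · filter_upwards [self_mem_nhdsWithin] with t ht
      have ht : t ≠ 0 := ht
      filter_upwards [h, coeFn_neg_I_smul G] with x h1 h2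
      rw [h2]
      refine (norm_sub_le _ _).trans ?_
      -- This dominates the quotients by `|xF| = |G|`, uniformly in `t`.
      have h3 : ‖Complex.exp (-(Complex.I * t * x)) - 1‖ ≤ |t| * |x| := by
        have := Real.norm_exp_I_mul_ofReal_sub_one_le (x := -(t * x))
        rw [norm_neg, norm_mul] at this
        convert! this using 4
        push_cast
        ring
      have h4 : ‖(t : ℂ)⁻¹ * ((Complex.exp (-(Complex.I * t * x)) - 1) * (F : ℝ → ℂ) x)‖
          ≤ ‖(G : ℝ → ℂ) x‖ := by
        rw [h1, norm_mul, norm_mul, norm_mul, norm_inv, Complex.norm_real, Complex.norm_real,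
          Real.norm_eq_abs, Real.norm_eq_abs, inv_mul_le_iff₀ (abs_pos.2 ht), ← mul_assoc]
        exact mul_le_mul_of_nonneg_right h3 (norm_nonneg _)
      rw [norm_neg, norm_mul Complex.I, Complex.norm_I, one_mul]
      linarith
    · filter_upwards [h, coeFn_neg_I_smul G] with x h1 h2
      rw [h2, h1]
      exact tendsto_slope_exp_mul x _

/-- The unitary group `Φ⁻¹ e ^ (-itx) Φ`. -/
noncomputable def laguerreGroup (Φ : EllTwo ≃ₗᵢ[ℂ] LTwoPos) (t : ℝ) : EllTwo ≃ₗᵢ[ℂ] EllTwo :=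
  (Φ.trans (mulExpEquiv t)).trans Φ.symm

lemma laguerreGroup_apply (Φ : EllTwo ≃ₗᵢ[ℂ] LTwoPos) (t : ℝ) (f : EllTwo) :
    laguerreGroup Φ t f = Φ.symm (mulExp t (Φ f)) := rfl

lemma isUnitaryGroupOf_laguerreGroup {p : ℝ} (hp : -1 < p) {Φ : EllTwo ≃ₗᵢ[ℂ] LTwoPos}
    (hΦ : IsLaguerreTransform p Φ) : IsUnitaryGroupOf (laguerreOperator p) (laguerreGroup Φ) where
  map_zero f := by rw [laguerreGroup_apply, mulExp_zero, Φ.symm_apply_apply]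
  map_add s t f := by
    simp only [laguerreGroup_apply, mulExp_add, Φ.apply_symm_apply]
  continuous f := Φ.symm.continuous.comp (continuous_mulExp (Φ f))
  generator f g := by
    rw [hΦ.mem_graph_iff hp, ← hasDerivAt_mulExp_zero_iff]
    constructor
    · intro h
      have h1 := ((Φ.symm.toContinuousLinearEquiv : LTwoPos →L[ℂ] EllTwo).restrictScalars ℝ
        ).hasFDerivAt.comp_hasDerivAt (0 : ℝ) h
      convert! h1 using 1
      simp
    · intro h
      have h1 := ((Φ.toContinuousLinearEquiv : EllTwo →L[ℂ] LTwoPos).restrictScalars ℝ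
        ).hasFDerivAt.comp_hasDerivAt (0 : ℝ) h
      convert! h1 using 1
      · funext t
        simp [laguerreGroup_apply]
      · simp

/-! ### From matrix elements to strong convergence -/

/-- The functionals are equicontinuous, so the vectors at which they converge form a closed
subspace, and it contains a total family. -/
lemma tendsto_apply_of_total {ι H : Type*} [NormedAddCommGroup H] [InnerProductSpace ℂ H]
    [CompleteSpace H] {l : Filter ℝ} {T : ℝ → H →ₗ[ℂ] ℂ} {T₀ : H →L[ℂ] ℂ} {C : NNReal}
    (hT : ∀ t f, ‖T t f‖ ≤ C * ‖f‖) {A : ι → H}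
    (hA : ∀ y, (∀ i, inner ℂ (A i) y = 0) → y = 0)
    (h : ∀ i, Tendsto (fun t => T t (A i)) l (𝓝 (T₀ (A i)))) (f : H) :
    Tendsto (fun t => T t f) l (𝓝 (T₀ f)) := by
  let K : Submodule ℂ H :=
    { carrier := {f | Tendsto (fun t => T t f) l (𝓝 (T₀ f))}
      add_mem' := fun {f g} hf hg => by
        simp only [Set.mem_ofPred_eq, map_add] at hf hg ⊢
        exact hf.add hg
      zero_mem' := by
        simp only [Set.mem_ofPred_eq, map_zero]
        exact tendsto_const_nhds
      smul_mem' := fun c f hf => by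
        simp only [Set.mem_ofPred_eq, map_smul] at hf ⊢
        exact hf.const_smul c }
  have hlip : ∀ t, LipschitzWith C (T t) := fun t =>
    AddMonoidHomClass.lipschitz_of_bound_nnnorm (T t) C (hT t)
  have hclosed : IsClosed (K : Set H) :=
    (LipschitzWith.uniformEquicontinuous (fun t => ⇑(T t)) C hlip).equicontinuous
      |>.isClosed_setOfPred_tendsto T₀.continuous
  have htop : (Submodule.span ℂ (Set.range A)).topologicalClosure = ⊤ := by
    rw [Submodule.topologicalClosure_eq_top_iff, Submodule.eq_bot_iff]
    exact fun y hy => hA y fun i =>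
      (Submodule.mem_orthogonal _ _).1 hy _ (Submodule.subset_span ⟨i, rfl⟩)
  have hle : (Submodule.span ℂ (Set.range A)).topologicalClosure ≤ K :=
    Submodule.topologicalClosure_minimal _ (Submodule.span_le.2 (by
      rintro _ ⟨i, rfl⟩
      exact h i)) hclosed
  exact hle (htop ▸ Submodule.mem_top)

/-- Totality of `A`, then of `B`, gives weak convergence. Isometry makes it strong: `‖S f - V f‖² =
2‖f‖² - 2 Re⟨S f, V f⟩`, which tends to 0. -/
lemma tendsto_of_tendsto_inner_total {ι κ H : Type*} [NormedAddCommGroup H]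
    [InnerProductSpace ℂ H] [CompleteSpace H] {l : Filter ℝ} {S : ℝ → H →ₗᵢ[ℂ] H} {V : H →ₗᵢ[ℂ] H}
    {A : ι → H} {B : κ → H} (hA : ∀ y, (∀ i, inner ℂ (A i) y = 0) → y = 0)
    (hB : ∀ y, (∀ j, inner ℂ (B j) y = 0) → y = 0)
    (h : ∀ i j, Tendsto (fun t => inner ℂ (B j) (S t (A i))) l (𝓝 (inner ℂ (B j) (V (A i)))))
    (f : H) : Tendsto (fun t => S t f) l (𝓝 (V f)) := by
  have h1 : ∀ j f, Tendsto (fun t => inner ℂ (B j) (S t f)) l (𝓝 (inner ℂ (B j) (V f))) := by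
    intro j f
    refine tendsto_apply_of_total (T := fun t => (innerₛₗ ℂ (B j)) ∘ₗ (S t).toLinearMap)
      (T₀ := (innerSL ℂ (B j)) ∘L V.toContinuousLinearMap) (C := ‖B j‖₊) (fun t g => ?_) hA
      (fun i => h i j) f
    have := norm_inner_le_norm (𝕜 := ℂ) (B j) (S t g)
    rw [LinearIsometry.norm_map] at this
    exact this
  have h2 : ∀ y f, Tendsto (fun t => inner ℂ (S t f) y) l (𝓝 (inner ℂ (V f) y)) := by
    intro y f
    refine tendsto_apply_of_total (T := fun t => innerₛₗ ℂ (S t f))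
      (T₀ := innerSL ℂ (V f)) (C := ‖f‖₊) (fun t g => ?_) hB (fun j => ?_) y
    · have := norm_inner_le_norm (𝕜 := ℂ) (S t f) g
      rw [LinearIsometry.norm_map] at this
      exact this
    · have := (Complex.continuous_conj.tendsto _).comp (h1 j f)
      simp only [Function.comp_def, inner_conj_symm] at this
      exact this
  rw [tendsto_iff_norm_sub_tendsto_zero]
  have h3 : Tendsto (fun t => ‖f‖ ^ 2 - 2 * RCLike.re (inner ℂ (S t f) (V f)) + ‖f‖ ^ 2) l
      (𝓝 (‖f‖ ^ 2 - 2 * RCLike.re (inner ℂ (V f) (V f)) + ‖f‖ ^ 2)) :=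
    ((((RCLike.continuous_re.tendsto _).comp (h2 (V f) f)).const_mul 2).const_sub _).add_const _
  have h4 : ‖f‖ ^ 2 - 2 * RCLike.re (inner ℂ (V f) (V f)) + ‖f‖ ^ 2 = 0 := by
    rw [inner_self_eq_norm_sq (𝕜 := ℂ), V.norm_map]
    ring
  rw [h4] at h3
  have h5 : Tendsto (fun t => ‖S t f - V f‖ ^ 2) l (𝓝 0) := by
    refine h3.congr fun t => ?_
    rw [@norm_sub_sq ℂ, LinearIsometry.norm_map, LinearIsometry.norm_map]
  have h6 := h5.sqrt
  simpa using h6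

lemma tendsto_laguerreGroup {p q : ℝ} (hp : -1 < p) (hq : -1 < q) {Φp Φq : EllTwo ≃ₗᵢ[ℂ] LTwoPos}
    (hΦp : IsLaguerreTransform p Φp) (hΦq : IsLaguerreTransform q Φq) {l : Filter ℝ}
    {ε : ℝ} (hε : ε = 1 ∨ ε = -1) (hl : ∀ᶠ t in l, t = ε * |t|)
    (habs : Tendsto (fun t : ℝ => |t|) l atTop) (f : EllTwo) :
    Tendsto (fun t => laguerreGroup Φq (-t) (laguerreGroup Φp t f)) l
      (𝓝 (Complex.exp (Complex.I * ((ε * ((q - p) * Real.pi / 2) : ℝ) : ℂ)) •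
        Φq.symm (Φp f))) := by
  set c := Complex.exp (Complex.I * ((ε * ((q - p) * Real.pi / 2) : ℝ) : ℂ)) with hc
  have hcn : ‖c‖ = 1 := by rw [hc, mul_comm, Complex.norm_exp_ofReal_mul_I]
  -- The family transported to `L²(ℝ₊)`, where its limit is expected to be the scalar `c`.
  let S : ℝ → LTwoPos →ₗᵢ[ℂ] LTwoPos := fun t =>
    (mulExp (-t)).comp ((Φp.symm.trans Φq).toLinearIsometry.comp (mulExp t))
  let V : LTwoPos →ₗᵢ[ℂ] LTwoPos :=
    { toLinearMap := c • LinearMap.id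
      norm_map' := fun F => by simp [norm_smul, hcn] }
  have hS : ∀ t F, S t F = mulExp (-t) (Φq (Φp.symm (mulExp t F))) := fun _ _ => rfl
  have hV : ∀ F, V F = c • F := fun _ => rfl
  have key : ∀ F, Tendsto (fun t => S t F) l (𝓝 (V F)) := by
    refine tendsto_of_tendsto_inner_total
      (A := fun τ : ℝ => mulExp τ (laguerreLp hp 0)) (B := fun τ : ℝ => mulExp τ (laguerreLp hq 0))
      (fun y => eq_zero_of_inner_mulExp_laguerreLp_eq_zero hp)
      (fun y => eq_zero_of_inner_mulExp_laguerreLp_eq_zero hq) fun τ τ' => ?_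
    rw [hV, inner_smul_right, inner_mulExp_mulExp, inner_laguerreLp_zero_mulExp_zero]
    refine tendsto_of_hasSum_laguerreAmplitude hp hq hε hl habs τ τ' fun t => ?_
    -- Moving `e^(itx)` to the left factor shifts both orbit times by `t`; the inner product is then
    -- computed in `ℓ²`, where the coordinates are the amplitudes.
    have h1 : inner ℂ (mulExp τ' (laguerreLp hq 0)) (S t (mulExp τ (laguerreLp hp 0)))
        = inner ℂ (Φq.symm (mulExp (τ' + t) (laguerreLp hq 0)))
          (Φp.symm (mulExp (τ + t) (laguerreLp hp 0))) := by
      rw [hS, ← (mulExp t).inner_map_map, ← mulExp_add, ← mulExp_add, ← mulExp_add,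
        add_neg_cancel, mulExp_zero, ← Φq.symm.inner_map_map, Φq.symm_apply_apply,
        add_comm t, add_comm t]
    rw [h1]
    have h2 := lp.hasSum_inner (𝕜 := ℂ) (Φq.symm (mulExp (τ' + t) (laguerreLp hq 0)))
      (Φp.symm (mulExp (τ + t) (laguerreLp hp 0)))
    simp only [hΦp.symm_apply hp, hΦq.symm_apply hq, inner_laguerreLp_mulExp_zero,
      RCLike.inner_apply] at h2
    simpa only [mul_comm] using h2
  have h1 := (Φq.symm.continuous.tendsto _).comp (key (Φp f))
  rw [hV, map_smul] at h1
  refine h1.congr fun t => ?_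
  simp [hS, laguerreGroup_apply]

/-! ### Failure of compactness -/

lemma jacobiMatrix_single_eq_zero (a b : ℕ → ℝ) {m n : ℕ} (h : m + 1 < n ∨ n + 1 < m) :
    jacobiMatrix a b ((lp.single 2 n (1 : ℂ) : EllTwo) : ℕ → ℂ) m = 0 := by
  rcases m with _ | m
  · have h0 : n ≠ 0 := by omega
    have h1 : n ≠ 1 := by omega
    simp [jacobiMatrix, h0.symm, h1.symm]
  · have h0 : m ≠ n := by omega
    have h1 : m + 1 ≠ n := by omega
    have h2 : m + 2 ≠ n := by omega
    simp [jacobiMatrix, h0, h1, h2]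

lemma jacobiMatrix_single_self (a b : ℕ → ℝ) (n : ℕ) :
    jacobiMatrix a b ((lp.single 2 n (1 : ℂ) : EllTwo) : ℕ → ℂ) n = b n := by
  rcases n with _ | n <;> simp [jacobiMatrix]

/-- A compact `K` would send some subsequence of the basis vectors to a convergent one. The limit
has zero coordinates since the difference is tridiagonal, yet its norm is at least the modulus of
the diagonal entry `q - p`. -/
lemma not_isCompactOperator_laguerreOperator_sub {p q : ℝ} (hpq : p ≠ q) :
    ¬ ∃ K : EllTwo →L[ℂ] EllTwo, IsCompactOperator K ∧
      ∀ f : (laguerreOperator q - laguerreOperator p).domain,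
        (laguerreOperator q - laguerreOperator p) f = K (f : EllTwo) := by
  rintro ⟨K, hK, hKf⟩
  let e : ℕ → EllTwo := fun n => lp.single 2 n (1 : ℂ)
  have hfin : ∀ (r : ℝ) (n : ℕ),
      Memℓp (jacobiMatrix (laguerreA r) (laguerreB r) (e n : ℕ → ℂ)) 2 := by
    intro r n
    -- The image of a basis vector is finitely supported, so each basis vector lies in both domains.
    refine (memℓp_zero ?_).of_exponent_ge (by norm_num)
    refine (Set.finite_Iic (n + 1)).subset fun m hm => ?_
    by_contra hmn
    exact hm (jacobiMatrix_single_eq_zero _ _ (Or.inr (not_le.1 hmn)))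
  have hKe : ∀ n m, (K (e n) : ℕ → ℂ) m
      = jacobiMatrix (laguerreA q) (laguerreB q) (e n : ℕ → ℂ) m
        - jacobiMatrix (laguerreA p) (laguerreB p) (e n : ℕ → ℂ) m := by
    intro n m
    have := hKf ⟨e n, hfin q n, hfin p n⟩
    simp only at this
    rw [← this]
    rfl
  have hmem : ∀ n, K (e n) ∈ closure (K '' Metric.closedBall 0 1) := fun n =>
    subset_closure ⟨e n, by simp [e], rfl⟩
  obtain ⟨v, -, φ, hφ, hv⟩ := (hK.isCompact_closure_image_closedBall 1).tendsto_subseq hmem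
  have hcoord : ∀ (g : EllTwo) (m : ℕ), inner ℂ (e m) g = (g : ℕ → ℂ) m := fun g m => by
    simp only [e]
    rw [lp.inner_single_left]
    simp
  have hv0 : v = 0 := by
    refine lp.ext (funext fun m => ?_)
    have h1 : Tendsto (fun k => inner ℂ (e m) (K (e (φ k)))) atTop (𝓝 (inner ℂ (e m) v)) :=
      tendsto_const_nhds.inner hv
    simp only [hcoord] at h1
    refine tendsto_nhds_unique h1 (tendsto_const_nhds.congr' ?_)
    filter_upwards [hφ.tendsto_atTop.eventually_gt_atTop (m + 1)] with k hk
    rw [hKe, jacobiMatrix_single_eq_zero _ _ (Or.inl hk),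
      jacobiMatrix_single_eq_zero _ _ (Or.inl hk), sub_zero]
    rfl
  have hlow : ∀ n, |q - p| ≤ ‖K (e n)‖ := by
    intro n
    have h1 := lp.norm_apply_le_norm (p := 2) (by norm_num) (K (e n)) n
    rw [hKe, jacobiMatrix_single_self, jacobiMatrix_single_self, ← Complex.ofReal_sub,
      Complex.norm_real, Real.norm_eq_abs] at h1
    refine le_trans (le_of_eq ?_) h1
    rw [laguerreB, laguerreB]
    congr 1
    ring
  have h1 := ge_of_tendsto' hv.norm fun k => hlow (φ k)
  rw [hv0, norm_zero] at h1
  exact (abs_pos.2 (sub_ne_zero.2 hpq.symm)).not_ge h1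

/-! ### The main theorem -/

theorem theorem1 :
    (∀ p : ℝ, -1 < p → ∃! Φ : EllTwo ≃ₗᵢ[ℂ] LTwoPos, IsLaguerreTransform p Φ) ∧
    (∀ p : ℝ, -1 < p → ∀ Φ : EllTwo ≃ₗᵢ[ℂ] LTwoPos, IsLaguerreTransform p Φ →
      ∀ f g : EllTwo, (f, g) ∈ (laguerreOperator p).graph ↔
        (Φ g : ℝ → ℂ) =ᵐ[volume.restrict (Set.Ioi (0 : ℝ))] fun x => (x : ℂ) * (Φ f : ℝ → ℂ) x) ∧
    ∀ p q : ℝ, -1 < p → -1 < q →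
      (p ≠ q → ¬ ∃ K : EllTwo →L[ℂ] EllTwo, IsCompactOperator K ∧
        ∀ f : (laguerreOperator q - laguerreOperator p).domain,
          (laguerreOperator q - laguerreOperator p) f = K (f : EllTwo)) ∧
      ∀ Φp Φq : EllTwo ≃ₗᵢ[ℂ] LTwoPos, IsLaguerreTransform p Φp → IsLaguerreTransform q Φq →
        IsWaveOperator atTop (laguerreOperator q) (laguerreOperator p)
          (Complex.exp (Complex.I * (((q - p) * Real.pi / 2 : ℝ) : ℂ)) •
            ((Φq.symm : LTwoPos →L[ℂ] EllTwo) ∘L (Φp : EllTwo →L[ℂ] LTwoPos))) ∧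
        IsWaveOperator atBot (laguerreOperator q) (laguerreOperator p)
          (Complex.exp (-Complex.I * (((q - p) * Real.pi / 2 : ℝ) : ℂ)) •
            ((Φq.symm : LTwoPos →L[ℂ] EllTwo) ∘L (Φp : EllTwo →L[ℂ] LTwoPos))) := by
  refine ⟨fun p hp => existsUnique_isLaguerreTransform hp,
    fun p hp Φ hΦ f g => hΦ.mem_graph_iff hp f g, fun p q hp hq =>
    ⟨not_isCompactOperator_laguerreOperator_sub, fun Φp Φq hΦp hΦq => ⟨?_, ?_⟩⟩⟩
  · refine ⟨laguerreGroup Φq, laguerreGroup Φp, isUnitaryGroupOf_laguerreGroup hq hΦq,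
      isUnitaryGroupOf_laguerreGroup hp hΦp, fun f => ?_⟩
    have h := tendsto_laguerreGroup hp hq hΦp hΦq (l := atTop) (Or.inl rfl)
      (by filter_upwards [eventually_ge_atTop 0] with t ht; rw [abs_of_nonneg ht, one_mul])
      tendsto_abs_atTop_atTop f
    simpa using h
  · refine ⟨laguerreGroup Φq, laguerreGroup Φp, isUnitaryGroupOf_laguerreGroup hq hΦq,
      isUnitaryGroupOf_laguerreGroup hp hΦp, fun f => ?_⟩
    have h := tendsto_laguerreGroup hp hq hΦp hΦq (l := atBot) (Or.inr rfl)
      (by filter_upwards [eventually_le_atBot 0] with t ht; rw [abs_of_nonpos ht]; ring)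
      tendsto_abs_atBot_atTop f
    simpa using h
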